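/- Let $l\ge 3$ and $r>l$ be integers and let $p\in[0,1/2]$. For every $n$ such that $r$ divides $nl$, let $\Gamma$ be drawn uniformly at random from the (simple, labelled) bipartite graphs with $n$ variable nodes, all of degree $l$, and $m=nl/r$ check nodes, all of degree $r$; write $\partial a$ for the set of neighbours of a check node $a$. The channel is the binary symmetric channel with inputs and outputs in $\{-1,1\}$ and transition probabilities $q(s\mid\sigma)=1-p$ if $s=\sigma$ and $q(s\mid\sigma)=p$ if $s\neq\sigma$. The all-$(+1)$ codeword is transmitted, so that the output $\underline s\in\{-1,1\}^n$ is i.i.d. with law $q(\cdot\mid 1)$. The posterior measure is $$\mu_\Gamma(\underline\sigma\mid\underline s)=\frac1{Z(\Gamma,\underline s)}\prod_{a}\frac12\Bigl(1+\prod_{i\in\partial a}\sigma_i\Bigr)\prod_{i}q(s_i\mid\sigma_i),\qquad \underline\sigma\in\{-1,1\}^n,$$ where $Z(\Gamma,\underline s)$ is the normalisation, and $\langle\cdot\rangle_{\mid\underline s}$ is the average with respect to it. The bit-sampling decoder estimates bit $i$ by a sample from the $i$-th marginal of this measure, and its bit-error probability is $$P_\Gamma^{\text{bit-sampling}}=\frac12\Bigl(1-\mathbb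 E_{\underline s}\Bigl[\frac1n\sum_{i=1}^n\langle\sigma_i\rangle_{\mid\underline s}\Bigr]\Bigr).$$ Let $$D(\rho)=\Bigl\{(x_0,x_c,\underline y)\in[0,1]^{2+\lfloor r/2\rfloor}\;:\;\sum_{t=1}^{\lfloor r/2\rfloor}y_t\le1,\ \sum_{t=1}^{\lfloor r/2\rfloor}\frac{2t}{r}y_t=(1-\rho)x_0+\rho x_c\Bigr\}$$ and, with $h_2(u)=-u\ln u-(1-u)\ln(1-u)$ and $0\ln0=0$, $$\begin{aligned}f(x_0,x_c,\underline y,\rho)={}&-l\,h_2\bigl((1-\rho)x_0+\rho x_c\bigr)+(1-\rho)h_2(x_0)+\rho h_2(x_c)\\&-\frac lr\Bigl(1-\sum_{t=1}^{\lfloor r/2\rfloor}y_t\Bigr)\ln\Bigl(1-\sum_{t=1}^{\lfloor r/2\rfloor}y_t\Bigr)-\frac lr\sum_{t=1}^{\lfloor r/2\rfloor}y_t\ln y_t+\frac lr\sum_{t=1}^{\lfloor r/2\rfloor}y_t\ln\binom r{2t},\end{aligned}$$ $$k(x_0,x_c,\rho,p)=\bigl(\rho x_c-(1-\rho)x_0\bigr)\ln\frac{1-p}p$$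 (for $p=0$ put $k=0$; the hypothesis below then never holds). Suppose that the function $f(x_0,x_c,\underline y,p)+k(x_0,x_c,p,p)$ attains its maximum over $D(p)$ only at the point $(0,0,0)$. Then $$\lim_{n\to\infty}\mathbb E_\Gamma\bigl[P_\Gamma^{\text{bit-sampling}}\bigr]=0,$$ the limit being taken along the integers $n$ such that $r$ divides $nl$. -/

import Mathlib

namespace LDPC

open Finset

/-! ### Codes on bipartite graphs

Binary symbols are the elements of `ℤˣ = {1, -1}`. A bipartite graph with variable nodes `Fin n` and
check nodes `Fin m` is given by its set of edges, a subset of `Fin n × Fin m`. -/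

/-- The neighbourhood `∂i` of a variable node `i`. -/
def varNbhd {n m : ℕ} (Γ : Finset (Fin n × Fin m)) (i : Fin n) : Finset (Fin m) :=
  univ.filter fun a => (i, a) ∈ Γ

/-- The neighbourhood `∂a` of a check node `a`. -/
def checkNbhd {n m : ℕ} (Γ : Finset (Fin n × Fin m)) (a : Fin m) : Finset (Fin n) :=
  univ.filter fun i => (i, a) ∈ Γ

/-- The `(l, r)` regular bipartite graphs on `n` variable nodes and `m` check nodes. -/
def regularGraphs (l r n m : ℕ) : Finset (Finset (Fin n × Fin m)) :=
  univ.filter fun Γ => (∀ i, (varNbhd Γ i).card = l) ∧ ∀ a, (checkNbhd Γ a).card = r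

/-- Transition probability `q(s ∣ σ)` of the binary symmetric channel with flipping
probability `p`. -/
noncomputable def bsc (p : ℝ) (s σ : ℤˣ) : ℝ := if s = σ then 1 - p else p

/-- The unnormalised posterior weight
`∏ₐ ½ (1 + ∏_{i ∈ ∂a} σᵢ) ∏ᵢ q(sᵢ ∣ σᵢ)` of the word `σ` given the channel output `s`. -/
noncomputable def weight {n m : ℕ} (Γ : Finset (Fin n × Fin m)) (p : ℝ) (s σ : Fin n → ℤˣ) : ℝ :=
  (∏ a, (1 / 2 : ℝ) * (1 + ∏ i ∈ checkNbhd Γ a, ((σ i : ℤ) : ℝ))) * ∏ i, bsc p (s i) (σ i)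

/-- The partition function `Z(Γ, s)`. -/
noncomputable def partitionFunction {n m : ℕ} (Γ : Finset (Fin n × Fin m)) (p : ℝ)
    (s : Fin n → ℤˣ) : ℝ :=
  ∑ σ : Fin n → ℤˣ, weight Γ p s σ

/-- The posterior probability `μ_Γ(σ ∣ s)`. -/
noncomputable def posterior {n m : ℕ} (Γ : Finset (Fin n × Fin m)) (p : ℝ)
    (s σ : Fin n → ℤˣ) : ℝ :=
  weight Γ p s σ / partitionFunction Γ p s

/-- The posterior average `⟨σᵢ⟩` given the channel output `s`. -/
noncomputable def magnetization {n m : ℕ} (Γ : Finset (Fin n × Fin m)) (p : ℝ)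
    (s : Fin n → ℤˣ) (i : Fin n) : ℝ :=
  ∑ σ : Fin n → ℤˣ, posterior Γ p s σ * ((σ i : ℤ) : ℝ)

/-- Expectation over the channel output when the all-`(+1)` codeword is transmitted. -/
noncomputable def outputExpect (n : ℕ) (p : ℝ) (X : (Fin n → ℤˣ) → ℝ) : ℝ :=
  ∑ s : Fin n → ℤˣ, (∏ i, bsc p (s i) 1) * X s

/-- The bit-error probability of the bit-sampling decoder for the graph `Γ`. -/
noncomputable def bitErrorProb {n m : ℕ} (Γ : Finset (Fin n × Fin m)) (p : ℝ) : ℝ :=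
  1 / 2 * (1 - outputExpect n p fun s => 1 / (n : ℝ) * ∑ i, magnetization Γ p s i)

/-- The expectation of the bit-error probability over the uniform distribution on the `(l, r)`
regular bipartite graphs with `n` variable nodes (and `n l / r` check nodes; only the lengths `n`
such that `r` divides `n l` are meaningful). -/
noncomputable def expectedBitErrorProb (l r n : ℕ) (p : ℝ) : ℝ :=
  (∑ Γ ∈ regularGraphs l r n (n * l / r), bitErrorProb Γ p) /
    ((regularGraphs l r n (n * l / r)).card : ℝ)

/-! ### The optimisation problem

A point `(x₀, x_c, y)` has `y = (y_1, …, y_{⌊r/2⌋})`; the entry `y_t` is stored at the index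
`t - 1 : Fin (r / 2)`. -/

/-- The domain `D(ρ)`. -/
def typeDomain (r : ℕ) (ρ : ℝ) : Set (ℝ × ℝ × (Fin (r / 2) → ℝ)) :=
  {z | z.1 ∈ Set.Icc 0 1 ∧ z.2.1 ∈ Set.Icc 0 1 ∧ (∀ t, z.2.2 t ∈ Set.Icc 0 1) ∧
    ∑ t, z.2.2 t ≤ 1 ∧
    ∑ t : Fin (r / 2), 2 * ((t : ℕ) + 1 : ℝ) / (r : ℝ) * z.2.2 t = (1 - ρ) * z.1 + ρ * z.2.1}

/-- The function `f(x₀, x_c, y, ρ)`; the convention is `0 ln 0 = 0`, and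
`Real.negMulLog u = -u ln u`. -/
noncomputable def f (l r : ℕ) (x₀ xc : ℝ) (y : Fin (r / 2) → ℝ) (ρ : ℝ) : ℝ :=
  -(l : ℝ) * Real.binEntropy ((1 - ρ) * x₀ + ρ * xc)
    + (1 - ρ) * Real.binEntropy x₀ + ρ * Real.binEntropy xc
    + (l : ℝ) / (r : ℝ) * Real.negMulLog (1 - ∑ t, y t)
    + (l : ℝ) / (r : ℝ) * ∑ t, Real.negMulLog (y t)
    + (l : ℝ) / (r : ℝ) * ∑ t, y t * Real.log (r.choose (2 * ((t : ℕ) + 1)) : ℝ)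

/-- The function `k(x₀, x_c, ρ, p)`. -/
noncomputable def k (x₀ xc ρ p : ℝ) : ℝ :=
  (ρ * xc - (1 - ρ) * x₀) * Real.log ((1 - p) / p)

/-- The set of maximisers of `F` over `S`. -/
def argmax {α : Type*} (F : α → ℝ) (S : Set α) : Set α := {z ∈ S | ∀ w ∈ S, F w ≤ F z}

end LDPC

/-!
The proof is a first moment computation. The bit-error probability is the mean fraction of entries
`-1` of a word drawn from the posterior (`LDPC.bitErrorProb_eq`), so words of weight below `δ n`
contribute at most `δ`. A heavier codeword `σ` has posterior probability at most its likelihood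
ratio with respect to the transmitted codeword (`LDPC.posterior_le`), which depends only on the
numbers of entries `-1` of `σ` at the flipped and at the unflipped positions and equals `exp (n k)`.
The expected number of codewords of a given type is at most `exp (n f)` up to a polynomial factor.
Since `(0, 0, 0)` is the only maximiser of `f + k`, where the value is `0`, compactness makes
`f + k ≤ -c` on the types of weight at least `δ n` whenever the fraction `ρ` of flipped bits is
within `c` of `p` (`LDPC.exists_exponent_gap`); other channel outputs are excluded by Chebyshev's
inequality.

The expected number of codewords is computed in the configuration model, where sockets of variable
nodes are matched to sockets of check nodes by a uniform bijection. All regular graphs are induced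
by the same number of configurations (`LDPC.card_edgeSet_eq`), so that it suffices that a
configuration has no parallel edges with probability at least the inverse of a polynomial in `n`.
This is `LDPC.factorial_le_card_simple`: by Markov's inequality at least half of the configurations
have a bounded number of parallel pairs, and these can be removed one by one by exchanging the
partners of two sockets. For configurations, a word of weight `w` is a codeword iff the image of
its `w l` sockets has an even number of elements at each check node; the number of such images is
bounded by the method of types (`LDPC.sum_prod_le_card_types`), and each of them has probability
`1 / (n l choose w l)`, which `LDPC.exp_binEntropy_le_choose` compares with an entropy
(`LDPC.card_isCodeword_le`).
-/

namespace LDPC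

open Finset

/-! ### The configuration model -/

/-- A configuration: a perfect matching between the `l` sockets of each of the `n` variable nodes
and the `r` sockets of each of the `m` check nodes. -/
abbrev Config (l r n m : ℕ) := Fin n × Fin l ≃ Fin m × Fin r

/-- The set of edges of the multigraph that a configuration induces; parallel edges are
identified. -/
def edgeSet {l r n m : ℕ} (π : Config l r n m) : Finset (Fin n × Fin m) :=
  univ.image fun u => (u.1, (π u).1)

/-- The ordered pairs of distinct variable sockets which carry parallel edges. -/
def parallelPairs {l r n m : ℕ} (π : Config l r n m) :
    Finset ((Fin n × Fin l) × (Fin n × Fin l)) :=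
  univ.filter fun e => e.1 ≠ e.2 ∧ e.1.1 = e.2.1 ∧ (π e.1).1 = (π e.2).1

lemma mem_parallelPairs {l r n m : ℕ} {π : Config l r n m} {e e' : Fin n × Fin l} :
    (e, e') ∈ parallelPairs π ↔ e ≠ e' ∧ e.1 = e'.1 ∧ (π e).1 = (π e').1 := by
  simp [parallelPairs]

lemma mem_edgeSet {l r n m : ℕ} {π : Config l r n m} {i : Fin n} {a : Fin m} :
    (i, a) ∈ edgeSet π ↔ ∃ k, (π (i, k)).1 = a := by
  simp [edgeSet]

lemma mem_edgeSet' {l r n m : ℕ} {π : Config l r n m} {i : Fin n} {a : Fin m} :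
    (i, a) ∈ edgeSet π ↔ ∃ j, (π.symm (a, j)).1 = i := by
  rw [mem_edgeSet]
  constructor
  · rintro ⟨k, rfl⟩
    exact ⟨(π (i, k)).2, by simp⟩
  · rintro ⟨j, rfl⟩
    exact ⟨(π.symm (a, j)).2, by simp⟩

lemma mem_regularGraphs {l r n m : ℕ} {Γ : Finset (Fin n × Fin m)} :
    Γ ∈ regularGraphs l r n m ↔
      (∀ i, (varNbhd Γ i).card = l) ∧ ∀ a, (checkNbhd Γ a).card = r := by
  simp [regularGraphs]

lemma varNbhd_edgeSet {l r n m : ℕ} (π : Config l r n m) (i : Fin n) :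
    varNbhd (edgeSet π) i = univ.image fun k => (π (i, k)).1 := by
  ext a; simp [varNbhd, mem_edgeSet]

lemma checkNbhd_edgeSet {l r n m : ℕ} (π : Config l r n m) (a : Fin m) :
    checkNbhd (edgeSet π) a = univ.image fun j => (π.symm (a, j)).1 := by
  ext i; simp [checkNbhd, mem_edgeSet']

lemma edgeSet_mem_regularGraphs {l r n m : ℕ} {π : Config l r n m} (h : parallelPairs π = ∅) :
    edgeSet π ∈ regularGraphs l r n m := by
  have key : ∀ u v, u.1 = v.1 → (π u).1 = (π v).1 → u = v := by
    intro u v h1 h2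
    by_contra hne
    have : (u, v) ∈ parallelPairs π := mem_parallelPairs.2 ⟨hne, h1, h2⟩
    simp [h] at this
  refine mem_regularGraphs.2 ⟨fun i => ?_, fun a => ?_⟩
  · rw [varNbhd_edgeSet, card_image_of_injective, card_univ, Fintype.card_fin]
    intro k k' hk
    simpa using key (i, k) (i, k') rfl hk
  · rw [checkNbhd_edgeSet, card_image_of_injective, card_univ, Fintype.card_fin]
    intro j j' hj
    simpa using key (π.symm (a, j)) (π.symm (a, j')) hj (by simp)

/-- The two ways of listing the edges of a graph, by variable node and by check node. -/
def edgesByNode {n m : ℕ} (Γ : Finset (Fin n × Fin m)) :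
    (Σ i, {a // (i, a) ∈ Γ}) ≃ Σ a, {i // (i, a) ∈ Γ} where
  toFun x := ⟨x.2.1, x.1, x.2.2⟩
  invFun x := ⟨x.2.1, x.1, x.2.2⟩
  left_inv _ := rfl
  right_inv _ := rfl

/-- The configuration obtained from a graph by numbering the edges at each of its nodes. -/
def configOfLabels {l r n m : ℕ} (Γ : Finset (Fin n × Fin m))
    (x : (∀ i, Fin l ≃ {a // (i, a) ∈ Γ}) × (∀ a, Fin r ≃ {i // (i, a) ∈ Γ})) :
    Config l r n m :=
  (Equiv.sigmaEquivProd _ _).symm.trans ((Equiv.sigmaCongrRight x.1).trans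
    ((edgesByNode Γ).trans ((Equiv.sigmaCongrRight x.2).symm.trans (Equiv.sigmaEquivProd _ _))))

lemma configOfLabels_apply {l r n m : ℕ} (Γ : Finset (Fin n × Fin m))
    (x : (∀ i, Fin l ≃ {a // (i, a) ∈ Γ}) × (∀ a, Fin r ≃ {i // (i, a) ∈ Γ}))
    (u : Fin n × Fin l) :
    configOfLabels Γ x u =
      ((x.1 u.1 u.2).1, (x.2 (x.1 u.1 u.2).1).symm ⟨u.1, (x.1 u.1 u.2).2⟩) := rfl

/-- Every regular graph is induced by the same number of configurations, namely by the ways of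
numbering the edges at its nodes. Hence a configuration conditioned to have no parallel edges
induces a uniform regular graph. -/
theorem card_edgeSet_eq {l r n m : ℕ} {Γ : Finset (Fin n × Fin m)}
    (hΓ : Γ ∈ regularGraphs l r n m) :
    (univ.filter fun π : Config l r n m => edgeSet π = Γ).card
      = l.factorial ^ n * r.factorial ^ m := by
  obtain ⟨hv, hc⟩ := mem_regularGraphs.1 hΓ
  have hv' : ∀ i, Fintype.card {a // (i, a) ∈ Γ} = l := fun i => by
    rw [Fintype.card_subtype]; exact hv i
  have hc' : ∀ a, Fintype.card {i // (i, a) ∈ Γ} = r := fun a => by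
    rw [Fintype.card_subtype]; exact hc a
  have hcard : Fintype.card ((∀ i, Fin l ≃ {a // (i, a) ∈ Γ}) × (∀ a, Fin r ≃ {i // (i, a) ∈ Γ}))
      = l.factorial ^ n * r.factorial ^ m := by
    have h1 : ∀ i, Fintype.card (Fin l ≃ {a // (i, a) ∈ Γ}) = l.factorial := fun i => by
      rw [Fintype.card_equiv (Fintype.equivOfCardEq (by simp [hv'])), Fintype.card_fin]
    have h2 : ∀ a, Fintype.card (Fin r ≃ {i // (i, a) ∈ Γ}) = r.factorial := fun a => by
      rw [Fintype.card_equiv (Fintype.equivOfCardEq (by simp [hc'])), Fintype.card_fin]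
    rw [Fintype.card_prod, Fintype.card_pi, Fintype.card_pi]
    simp [h1, h2]
  rw [← hcard, ← card_univ]
  symm
  refine card_bij (fun x _ => configOfLabels Γ x) ?_ ?_ ?_
  · intro x _
    simp only [mem_filter, mem_univ, true_and]
    ext ⟨i, a⟩
    rw [mem_edgeSet]
    constructor
    · rintro ⟨k, rfl⟩
      exact (x.1 i k).2
    · intro h
      exact ⟨(x.1 i).symm ⟨a, h⟩, by simp [configOfLabels_apply]⟩
  · intro x _ y _ hxy
    refine Prod.ext (funext fun i => Equiv.ext fun k => Subtype.ext ?_)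
      (funext fun a => Equiv.ext fun j => Subtype.ext ?_)
    · exact congrArg Prod.fst (DFunLike.congr_fun hxy (i, k))
    · exact congrArg (fun π : Config l r n m => (π.symm (a, j)).1) hxy
  · intro π hπ
    obtain rfl : edgeSet π = Γ := by simpa using hπ
    have bv : ∀ i, Function.Bijective fun k : Fin l =>
        (⟨(π (i, k)).1, mem_edgeSet.2 ⟨k, rfl⟩⟩ : {a // (i, a) ∈ edgeSet π}) := fun i => by
      rw [Fintype.bijective_iff_surjective_and_card]
      refine ⟨?_, by simp [hv']⟩
      rintro ⟨a, ha⟩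
      obtain ⟨k, rfl⟩ := mem_edgeSet.1 ha
      exact ⟨k, rfl⟩
    have bc : ∀ a, Function.Bijective fun j : Fin r =>
        (⟨(π.symm (a, j)).1, mem_edgeSet'.2 ⟨j, rfl⟩⟩ : {i // (i, a) ∈ edgeSet π}) := fun a => by
      rw [Fintype.bijective_iff_surjective_and_card]
      refine ⟨?_, by simp [hc']⟩
      rintro ⟨i, hi⟩
      obtain ⟨j, rfl⟩ := mem_edgeSet'.1 hi
      exact ⟨j, rfl⟩
    refine ⟨(fun i => Equiv.ofBijective _ (bv i), fun a => Equiv.ofBijective _ (bc a)),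
      mem_univ _, ?_⟩
    refine Equiv.ext fun u => ?_
    rw [configOfLabels_apply]
    refine Prod.ext rfl ?_
    refine (Equiv.symm_apply_eq _).2 (Subtype.ext ?_)
    change u.1 = (π.symm ((π u).1, (π u).2)).1
    simp

/-- There are at most `|A|! (N - |A|)!` bijections that map a given set `A` onto a given set
`B`. -/
theorem card_equiv_mapsTo_le {α β : Type*} [Fintype α] [DecidableEq α] [Fintype β] [DecidableEq β]
    (A : Finset α) (B : Finset β) :
    (univ.filter fun π : α ≃ β => ∀ x, x ∈ A ↔ π x ∈ B).card
      ≤ A.card.factorial * (Fintype.card α - A.card).factorial := by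
  have hle : ∀ (γ δ : Type _) [Fintype γ] [DecidableEq γ] [Fintype δ] [DecidableEq δ],
      Fintype.card (γ ≃ δ) ≤ (Fintype.card γ).factorial := by
    intro γ δ _ _ _ _
    rcases isEmpty_or_nonempty (γ ≃ δ) with h | ⟨⟨e⟩⟩
    · simp
    · exact (Fintype.card_equiv e).le
  calc (univ.filter fun π : α ≃ β => ∀ x, x ∈ A ↔ π x ∈ B).card
      = Fintype.card {π : α ≃ β // ∀ x, x ∈ A ↔ π x ∈ B} := (Fintype.card_subtype _).symm
    _ ≤ Fintype.card (({x // x ∈ A} ≃ {y // y ∈ B}) × ({x // x ∉ A} ≃ {y // y ∉ B})) := by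
        refine Fintype.card_le_of_injective (fun π => (π.1.subtypeEquiv π.2,
          π.1.subtypeEquiv fun x => not_congr (π.2 x))) ?_
        rintro ⟨π, hπ⟩ ⟨π', hπ'⟩ h
        simp only [Prod.mk.injEq] at h
        refine Subtype.ext (Equiv.ext fun x => ?_)
        by_cases hx : x ∈ A
        · exact congrArg Subtype.val (DFunLike.congr_fun h.1 ⟨x, hx⟩)
        · exact congrArg Subtype.val (DFunLike.congr_fun h.2 ⟨x, hx⟩)
    _ ≤ _ := by
        rw [Fintype.card_prod]
        refine Nat.mul_le_mul ((hle _ _).trans ?_) ((hle _ _).trans ?_)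
        · rw [Fintype.card_coe]
        · rw [Fintype.card_subtype_compl, Fintype.card_coe]

/-! ### Configurations without parallel edges -/

/-- Parallel edges are removed one at a time: exchanging the partner of a socket on a parallel edge
with that of a socket on an edge far away creates no new parallel pair. -/
lemma exists_swap_parallelPairs_lt {l r n m : ℕ} (hn : 2 * r < n) (π : Config l r n m)
    (h : parallelPairs π ≠ ∅) :
    ∃ e e', (parallelPairs ((Equiv.swap e e').trans π)).card < (parallelPairs π).card := by
  obtain ⟨⟨e, e₁⟩, he⟩ := nonempty_iff_ne_empty.2 h
  obtain ⟨hne, hi, ha⟩ : e ≠ e₁ ∧ e.1 = e₁.1 ∧ (π e).1 = (π e₁).1 :=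
    mem_parallelPairs.1 he
  have hl : 0 < l := e.2.pos
  -- the sockets whose check node is a neighbour of `e.1`
  let B₁ : Finset (Fin n × Fin l) :=
    univ.image fun x : Fin l × Fin r => π.symm ((π (e.1, x.1)).1, x.2)
  -- the sockets whose variable node is a neighbour of `(π e).1`
  let B₂ : Finset (Fin n × Fin l) :=
    univ.image fun x : Fin r × Fin l => ((π.symm ((π e).1, x.1)).1, x.2)
  have hB : (B₁ ∪ B₂).card < (univ : Finset (Fin n × Fin l)).card := by
    have h1 : B₁.card ≤ l * r := card_image_le.trans (by simp)
    have h2 : B₂.card ≤ r * l := card_image_le.trans (by simp)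
    have h3 := card_union_le B₁ B₂
    have h4 : (univ : Finset (Fin n × Fin l)).card = n * l := by simp
    rw [h4]
    nlinarith [Nat.mul_lt_mul_of_pos_right hn hl]
  obtain ⟨e', -, he'⟩ := exists_mem_notMem_of_card_lt_card hB
  simp only [mem_union, not_or] at he'
  have hB1 : ∀ x : Fin n × Fin l, x.1 = e.1 → (π x).1 ≠ (π e').1 := by
    intro x hx hx'
    refine he'.1 (mem_image.2 ⟨(x.2, (π e').2), mem_univ _, ?_⟩)
    rw [← hx, Prod.mk.eta, hx', Prod.mk.eta, Equiv.symm_apply_apply]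
  have hB2 : ∀ x : Fin n × Fin l, x.1 = e'.1 → (π x).1 ≠ (π e).1 := by
    intro x hx hx'
    refine he'.2 (mem_image.2 ⟨((π x).2, e'.2), mem_univ _, ?_⟩)
    rw [← hx', Prod.mk.eta, Equiv.symm_apply_apply, hx]
  refine ⟨e, e', card_lt_card ?_⟩
  have hee : e'.1 ≠ e.1 := fun h => hB1 e' h rfl
  have hne' : e ≠ e' := fun h => hee (by rw [h])
  have hsub : ∀ x y, x ≠ y → x.1 = y.1 → (π (Equiv.swap e e' x)).1 = (π (Equiv.swap e e' y)).1 →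
      x ≠ e ∧ x ≠ e' := by
    intro x y hxy hv hc
    refine ⟨?_, ?_⟩
    · rintro rfl
      have hy : y ≠ e' := by rintro rfl; exact hee hv.symm
      rw [Equiv.swap_apply_left, Equiv.swap_apply_of_ne_of_ne hxy.symm hy] at hc
      exact hB1 y hv.symm hc.symm
    · rintro rfl
      have hy : y ≠ e := by rintro rfl; exact hee hv
      rw [Equiv.swap_apply_right, Equiv.swap_apply_of_ne_of_ne hy hxy.symm] at hc
      exact hB2 y hv.symm hc.symm
  refine (ssubset_iff_of_subset ?_).2 ⟨(e, e₁), he, ?_⟩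
  · rintro ⟨x, y⟩ hxy
    rw [mem_parallelPairs] at hxy ⊢
    obtain ⟨h1, h2, h3⟩ := hxy
    obtain ⟨hx, hx'⟩ := hsub x y h1 h2 h3
    obtain ⟨hy, hy'⟩ := hsub y x h1.symm h2.symm h3.symm
    rw [Equiv.trans_apply, Equiv.trans_apply, Equiv.swap_apply_of_ne_of_ne hx hx',
      Equiv.swap_apply_of_ne_of_ne hy hy'] at h3
    exact ⟨h1, h2, h3⟩
  · intro hmem
    rw [mem_parallelPairs] at hmem
    exact (hsub e e₁ hmem.1 hmem.2.1 hmem.2.2).1 rfl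

/-- Each parallel pair that has to be removed costs a choice of two sockets, that is, a factor
`(n l)²`. -/
lemma card_parallelPairs_le_mul {l r n m : ℕ} (hn : 2 * r < n) (hl : 0 < l) (k : ℕ) :
    (univ.filter fun π : Config l r n m => (parallelPairs π).card ≤ k).card
      ≤ ((n * l) ^ 2) ^ k
        * (univ.filter fun π : Config l r n m => parallelPairs π = ∅).card := by
  induction k with
  | zero => simp
  | succ k ih =>
    have hsub : (univ.filter fun π : Config l r n m => (parallelPairs π).card ≤ k + 1) ⊆
        ((univ : Finset ((Fin n × Fin l) × (Fin n × Fin l))) ×ˢ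
          univ.filter fun π : Config l r n m => (parallelPairs π).card ≤ k).image
          fun x => (Equiv.swap x.1.1 x.1.2).trans x.2 := by
      intro π hπ
      have hπ' : (parallelPairs π).card ≤ k + 1 := by simpa using hπ
      obtain ⟨e, e', he⟩ : ∃ e e', (parallelPairs ((Equiv.swap e e').trans π)).card ≤ k := by
        by_cases h : parallelPairs π = ∅
        · refine ⟨(⟨0, by lia⟩, ⟨0, hl⟩), (⟨0, by lia⟩, ⟨0, hl⟩), ?_⟩
          simp [h]
        · obtain ⟨e, e', he⟩ := exists_swap_parallelPairs_lt hn π h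
          exact ⟨e, e', by lia⟩
      refine mem_image.2 ⟨((e, e'), (Equiv.swap e e').trans π), by simpa using he, ?_⟩
      ext x <;> simp
    calc _ ≤ _ := (card_le_card hsub).trans card_image_le
      _ = (n * l) ^ 2 *
          (univ.filter fun π : Config l r n m => (parallelPairs π).card ≤ k).card := by
        simp [card_product, sq]
      _ ≤ (n * l) ^ 2 * _ := Nat.mul_le_mul_left _ ih
      _ = _ := by rw [pow_succ]; ring

/-- First moment of the number of parallel pairs of a uniform configuration. -/
lemma sum_card_parallelPairs_le {l r n m : ℕ} (hN : n * l = m * r) (h2 : 2 ≤ n * l) :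
    ∑ π : Config l r n m, (parallelPairs π).card ≤ 4 * l * r * (n * l).factorial := by
  classical
  -- the possible positions of a parallel pair together with its images
  let S : Finset (((Fin n × Fin l) × (Fin n × Fin l)) × ((Fin m × Fin r) × (Fin m × Fin r))) :=
    univ.filter fun x => (x.1.1 ≠ x.1.2 ∧ x.1.1.1 = x.1.2.1) ∧ (x.2.1 ≠ x.2.2 ∧ x.2.1.1 = x.2.2.1)
  have hS : S.card ≤ (n * l) ^ 2 * (l * r) := by
    let g : (Fin n × Fin l × Fin l) × (Fin m × Fin r × Fin r) →
        ((Fin n × Fin l) × (Fin n × Fin l)) × ((Fin m × Fin r) × (Fin m × Fin r)) :=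
      fun x => (((x.1.1, x.1.2.1), (x.1.1, x.1.2.2)), ((x.2.1, x.2.2.1), (x.2.1, x.2.2.2)))
    have : S ⊆ univ.image g := by
      rintro ⟨⟨⟨i, k⟩, ⟨i', k'⟩⟩, ⟨⟨a, j⟩, ⟨a', j'⟩⟩⟩ hx
      obtain ⟨⟨-, rfl⟩, -, rfl⟩ : ((_ ∧ i = i') ∧ _ ∧ a = a') := by simpa [S] using hx
      exact mem_image.2 ⟨((i, k, k'), (a, j, j')), mem_univ _, rfl⟩
    refine (card_le_card this).trans (card_image_le.trans (le_of_eq ?_))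
    simp only [card_univ, Fintype.card_prod, Fintype.card_fin]
    calc n * (l * l) * (m * (r * r)) = (n * l) * (m * r) * (l * r) := by ring
      _ = _ := by rw [← hN]; ring
  have hle : ∀ π : Config l r n m, (parallelPairs π).card
      ≤ ∑ x ∈ S, if (∀ u, u ∈ ({x.1.1, x.1.2} : Finset _) ↔ π u ∈ ({x.2.1, x.2.2} : Finset _))
        then 1 else 0 := by
    intro π
    rw [← card_filter]
    refine card_le_card_of_injOn (fun e => (e, (π e.1, π e.2))) ?_ ?_
    · intro e he
      have he' : e.1 ≠ e.2 ∧ e.1.1 = e.2.1 ∧ (π e.1).1 = (π e.2).1 :=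
        mem_parallelPairs.1 he
      simp [S, he'.1, he'.2.1, he'.2.2]
    · intro e _ e' _ h
      exact congrArg Prod.fst h
  calc ∑ π : Config l r n m, (parallelPairs π).card
      ≤ ∑ π : Config l r n m, ∑ x ∈ S,
        if (∀ u, u ∈ ({x.1.1, x.1.2} : Finset _) ↔ π u ∈ ({x.2.1, x.2.2} : Finset _))
        then 1 else 0 := sum_le_sum fun π _ => hle π
    _ = ∑ x ∈ S, (univ.filter fun π : Config l r n m =>
        ∀ u, u ∈ ({x.1.1, x.1.2} : Finset _) ↔ π u ∈ ({x.2.1, x.2.2} : Finset _)).card := by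
        rw [sum_comm]
        simp only [card_filter]
    _ ≤ ∑ x ∈ S, 2 * (n * l - 2).factorial := by
        refine sum_le_sum fun x hx => ?_
        have hx' : x.1.1 ≠ x.1.2 := by
          have := (mem_filter.1 hx).2.1.1
          exact this
        refine (card_equiv_mapsTo_le _ _).trans ?_
        rw [card_pair hx']
        simp
    _ ≤ (n * l) ^ 2 * (l * r) * (2 * (n * l - 2).factorial) := by
        rw [sum_const, smul_eq_mul]
        exact Nat.mul_le_mul_right _ hS
    _ ≤ 4 * l * r * (n * l).factorial := by
        obtain ⟨k, hk⟩ := Nat.exists_eq_add_of_le h2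
        rw [hk, show 2 + k - 2 = k by lia, show 2 + k = (k + 1) + 1 by lia, Nat.factorial_succ,
          Nat.factorial_succ]
        have : (k + 1 + 1) ^ 2 ≤ 2 * ((k + 1 + 1) * (k + 1)) := by nlinarith
        calc _ = (k + 1 + 1) ^ 2 * (2 * (l * r) * k.factorial) := by ring
          _ ≤ 2 * ((k + 1 + 1) * (k + 1)) * (2 * (l * r) * k.factorial) :=
            Nat.mul_le_mul_right _ this
          _ = _ := by ring

/-- The probability that a configuration has no parallel edges is at least inverse polynomial:
by Markov's inequality half of the configurations have boundedly many parallel pairs, and these are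
turned into configurations without parallel edges by boundedly many exchanges. -/
theorem factorial_le_card_simple {l r n m : ℕ} (hl : 0 < l) (hr : 0 < r) (hn : 2 * r < n)
    (hN : n * l = m * r) :
    (n * l).factorial ≤ 2 * ((n * l) ^ 2) ^ (8 * l * r)
      * (univ.filter fun π : Config l r n m => parallelPairs π = ∅).card := by
  have h2 : 2 ≤ n * l := by nlinarith
  have htot : Fintype.card (Config l r n m) = (n * l).factorial := by
    rw [Fintype.card_equiv (Fintype.equivOfCardEq (by simp [hN]))]; simp
  have hM := sum_card_parallelPairs_le (r := r) (m := m) hN h2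
  have hbad : (8 * l * r) * (univ.filter fun π : Config l r n m =>
      ¬ (parallelPairs π).card ≤ 8 * l * r).card ≤ 4 * l * r * (n * l).factorial := by
    refine le_trans ?_ hM
    rw [mul_comm, ← smul_eq_mul, ← sum_const]
    refine (sum_le_sum fun π hπ => ?_).trans (sum_le_univ_sum_of_nonneg fun _ => Nat.zero_le _)
    exact (not_le.1 (mem_filter.1 hπ).2).le
  have hsplit := card_filter_add_card_filter_not
    (s := (univ : Finset (Config l r n m))) (fun π => (parallelPairs π).card ≤ 8 * l * r)
  rw [card_univ, htot] at hsplit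
  have hk := card_parallelPairs_le_mul (m := m) (r := r) hn hl (8 * l * r)
  have hpos : 0 < 4 * l * r := by positivity
  have hbad' : 2 * (univ.filter fun π : Config l r n m =>
      ¬ (parallelPairs π).card ≤ 8 * l * r).card ≤ (n * l).factorial := by
    refine Nat.le_of_mul_le_mul_left ?_ hpos
    calc _ = _ := by ring
      _ ≤ _ := hbad
  calc (n * l).factorial
      ≤ 2 * (univ.filter fun π : Config l r n m => (parallelPairs π).card ≤ 8 * l * r).card := by
        lia
    _ ≤ _ := (Nat.mul_le_mul_left 2 hk).trans_eq (mul_assoc _ _ _).symm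

/-! ### The method of types -/

/-- Method of types: if every word `g` is weighted by its probability under a product measure that
depends on the type `T g` only, then the total weight is at most the number of types. -/
theorem sum_prod_le_card_types {ι α τ : Type*} [Fintype ι] [DecidableEq ι] [Fintype α] [Fintype τ]
    [DecidableEq τ] (T : (ι → α) → τ) (q : τ → ι → α → ℝ)
    (hq0 : ∀ g i a, 0 ≤ q (T g) i a) (hq1 : ∀ g i, ∑ a, q (T g) i a ≤ 1) :
    ∑ g, ∏ i, q (T g) i (g i) ≤ Fintype.card τ := by
  calc ∑ g, ∏ i, q (T g) i (g i)
      = ∑ t, ∑ g with T g = t, ∏ i, q (T g) i (g i) := (sum_fiberwise _ _ _).symm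
    _ ≤ ∑ _t : τ, 1 := by
        refine sum_le_sum fun t _ => ?_
        rcases (univ.filter fun g => T g = t).eq_empty_or_nonempty with h | ⟨g₀, h₀⟩
        · rw [h]; simp
        · obtain rfl : T g₀ = t := by simpa using h₀
          calc ∑ g with T g = T g₀, ∏ i, q (T g) i (g i)
              = ∑ g with T g = T g₀, ∏ i, q (T g₀) i (g i) :=
                sum_congr rfl fun g hg => by rw [(mem_filter.1 hg).2]
            _ ≤ ∑ g : ι → α, ∏ i, q (T g₀) i (g i) :=
                sum_le_univ_sum_of_nonneg fun g => prod_nonneg fun i _ => hq0 g₀ i (g i)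
            _ = ∏ i, ∑ a, q (T g₀) i a := by
                rw [prod_univ_sum, Fintype.piFinset_univ]
            _ ≤ 1 := prod_le_one (fun i _ => sum_nonneg fun a _ => hq0 g₀ i a)
                fun i _ => hq1 g₀ i
    _ = Fintype.card τ := by simp

/-- A sequence of biased bits with its own frequency as bias has probability
`exp (-N h)`. -/
lemma prod_frequency_eq_exp {ι : Type*} (A : Finset ι) (P : ι → Prop) [DecidablePred P] (x : ℝ)
    (hx : x = ((A.filter P).card : ℝ) / A.card) :
    ∏ i ∈ A, (if P i then x else 1 - x) = Real.exp (-(A.card * Real.binEntropy x)) := by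
  have hpos : ∀ i ∈ A, 0 < if P i then x else 1 - x := by
    intro i hi
    have hA : (0 : ℝ) < A.card := by exact_mod_cast card_pos.2 ⟨i, hi⟩
    split_ifs with h
    · rw [hx]
      have : 0 < (A.filter P).card := card_pos.2 ⟨i, mem_filter.2 ⟨hi, h⟩⟩
      positivity
    · rw [hx, sub_pos, div_lt_one hA]
      exact_mod_cast card_lt_card (filter_ssubset.2 ⟨i, hi, h⟩)
  rw [← Real.exp_log (prod_pos hpos), Real.log_prod (fun i hi => (hpos i hi).ne')]
  congr 1
  rcases A.eq_empty_or_nonempty with rfl | hne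
  · simp
  have hA : (A.card : ℝ) ≠ 0 := by exact_mod_cast (card_pos.2 hne).ne'
  rw [← sum_filter_add_sum_filter_not A P]
  have h1 : ∑ i ∈ A with P i, Real.log (if P i then x else 1 - x)
      = (A.filter P).card * Real.log x := by
    rw [← nsmul_eq_mul, ← sum_const]
    exact sum_congr rfl fun i hi => by rw [if_pos (mem_filter.1 hi).2]
  have h2 : ∑ i ∈ A with ¬ P i, Real.log (if P i then x else 1 - x)
      = (A.filter fun i => ¬ P i).card * Real.log (1 - x) := by
    rw [← nsmul_eq_mul, ← sum_const]
    exact sum_congr rfl fun i hi => by rw [if_neg (mem_filter.1 hi).2]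
  have h3 : ((A.filter P).card : ℝ) + (A.filter fun i => ¬ P i).card = A.card := by
    exact_mod_cast card_filter_add_card_filter_not (s := A) P
  have h4 : ((A.filter P).card : ℝ) = A.card * x := by rw [hx]; field_simp
  have h5 : ((A.filter fun i => ¬ P i).card : ℝ) = A.card * (1 - x) := by linarith
  rw [h1, h2, h4, h5, Real.binEntropy_eq_negMulLog_add_negMulLog_one_sub]
  simp only [Real.negMulLog]
  ring

/-- The binomial distribution with parameters `N` and `k / N` has its mode at `k`. -/
lemma choose_mul_pow_le {N k j : ℕ} (hk : k ≤ N) (hj : j ≤ N) :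
    N.choose j * (k ^ j * (N - k) ^ (N - j)) ≤ N.choose k * (k ^ k * (N - k) ^ (N - k)) := by
  have key : ∀ a b : ℕ, a.factorial * a ^ b ≤ b.factorial * a ^ a := by
    intro a b
    rcases le_total a b with h | h
    · calc a.factorial * a ^ b = (a.factorial * a ^ (b - a)) * a ^ a := by
            rw [mul_assoc, ← pow_add, Nat.sub_add_cancel h]
        _ ≤ b.factorial * a ^ a :=
            Nat.mul_le_mul_right _ (Nat.factorial_mul_pow_sub_le_factorial h)
    · calc a.factorial * a ^ b ≤ (b.factorial * a ^ (a - b)) * a ^ b := by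
            refine Nat.mul_le_mul_right _ ?_
            obtain ⟨c, rfl⟩ := Nat.exists_eq_add_of_le h
            rw [Nat.add_sub_cancel_left]
            rw [← Nat.factorial_mul_ascFactorial]
            exact Nat.mul_le_mul_left _ (Nat.ascFactorial_le_pow_add b c)
        _ = b.factorial * a ^ a := by
            rw [mul_assoc, ← pow_add, Nat.sub_add_cancel h]
  have h1 := Nat.choose_mul_factorial_mul_factorial hj
  have h2 := Nat.choose_mul_factorial_mul_factorial hk
  have hpos : 0 < (j.factorial * (N - j).factorial) * (k.factorial * (N - k).factorial) := by
    positivity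
  refine Nat.le_of_mul_le_mul_left ?_ hpos
  calc _ = (N.choose j * j.factorial * (N - j).factorial) *
        ((k.factorial * k ^ j) * ((N - k).factorial * (N - k) ^ (N - j))) := by ring
    _ ≤ (N.choose k * k.factorial * (N - k).factorial) *
        ((j.factorial * k ^ k) * ((N - j).factorial * (N - k) ^ (N - k))) := by
        rw [h1, h2]
        exact Nat.mul_le_mul_left _ (Nat.mul_le_mul (key _ _) (key _ _))
    _ = _ := by ring

/-- The mode of the binomial distribution with parameters `N` and `k / N` has probability at least
`1 / (N + 1)`. -/
lemma exp_binEntropy_le_choose {N k : ℕ} (hk : k ≤ N) :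
    Real.exp (N * Real.binEntropy ((k : ℝ) / N)) ≤ (N + 1) * N.choose k := by
  rcases Nat.eq_zero_or_pos N with rfl | hN
  · obtain rfl : k = 0 := by lia
    simp
  have hN' : (0 : ℝ) < N := by exact_mod_cast hN
  have hfil : (range N).filter (fun i => i < k) = range k := by
    ext i; simp; lia
  have h1 := prod_frequency_eq_exp (range N) (fun i => i < k) ((k : ℝ) / N) (by rw [hfil]; simp)
  rw [prod_ite, hfil, prod_const, prod_const, card_range] at h1
  have h2 : ((range N).filter fun i => ¬ i < k).card = N - k := by
    have := card_filter_add_card_filter_not (s := range N) (fun i => i < k)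
    rw [hfil, card_range, card_range] at this
    lia
  rw [h2, card_range, Real.exp_neg] at h1
  have h3 : N ^ N ≤ (N + 1) * (N.choose k * (k ^ k * (N - k) ^ (N - k))) := by
    calc N ^ N = (k + (N - k)) ^ N := by rw [Nat.add_sub_cancel' hk]
      _ = ∑ j ∈ range (N + 1), N.choose j * (k ^ j * (N - k) ^ (N - j)) := by
        rw [add_pow]; exact sum_congr rfl fun j _ => by simp; ring
      _ ≤ ∑ j ∈ range (N + 1), N.choose k * (k ^ k * (N - k) ^ (N - k)) :=
        sum_le_sum fun j hj => choose_mul_pow_le hk (by simpa [Nat.lt_succ_iff] using hj)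
      _ = _ := by simp
  have h4 : (1 : ℝ) ≤ (N + 1) * N.choose k * (((k : ℝ) / N) ^ k * (1 - (k : ℝ) / N) ^ (N - k)) := by
    have h5 : (N : ℝ) ^ N ≤ (N + 1) * (N.choose k * ((k : ℝ) ^ k * ((N : ℝ) - k) ^ (N - k))) := by
      have := (Nat.cast_le (α := ℝ)).2 h3
      push_cast [Nat.cast_sub hk] at this
      exact this
    have h6 : 1 - (k : ℝ) / N = (N - k) / N := by field_simp
    have h7 : (N : ℝ) ^ k * (N : ℝ) ^ (N - k) = (N : ℝ) ^ N := by
      rw [← pow_add, Nat.add_sub_cancel' hk]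
    rw [h6, div_pow, div_pow, div_mul_div_comm, h7, ← mul_div_assoc, one_le_div (by positivity)]
    linarith
  rw [h1] at h4
  have h8 := Real.exp_pos (N * Real.binEntropy ((k : ℝ) / N))
  rwa [← div_eq_mul_inv, one_le_div h8] at h4

/-! ### Types of words -/

/-- The number of entries `-1` of a word. -/
def negCount {n : ℕ} (σ : Fin n → ℤˣ) : ℕ := (univ.filter fun i => σ i = -1).card

/-- The number of positions at which the channel output `s` is `u` and the word `σ` is `-1`. -/
def negCountOn {n : ℕ} (s σ : Fin n → ℤˣ) (u : ℤˣ) : ℕ :=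
  ((univ.filter fun i => s i = u).filter fun i => σ i = -1).card

/-- The fraction of entries `-1` of the word `σ` among the positions at which the channel output
`s` is `u` (and `0` if there are no such positions). -/
noncomputable def negFraction {n : ℕ} (s σ : Fin n → ℤˣ) (u : ℤˣ) : ℝ :=
  (negCountOn s σ u : ℝ) / (univ.filter fun i => s i = u).card

/-- The exponential growth rate, times `n`, of the number of words of the same type as `σ`
relative to the channel output `s`. -/
noncomputable def wordExponent {n : ℕ} (s σ : Fin n → ℤˣ) : ℝ :=
  ∑ u : ℤˣ, (univ.filter fun i => s i = u).card * Real.binEntropy (negFraction s σ u)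

lemma negFraction_mem_Icc {n : ℕ} (s σ : Fin n → ℤˣ) (u : ℤˣ) :
    negFraction s σ u ∈ Set.Icc (0 : ℝ) 1 :=
  ⟨by unfold negFraction; positivity,
    div_le_one_of_le₀ (by exact_mod_cast card_filter_le _ _) (by positivity)⟩

/-- There are polynomially many types of words, and `exp (wordExponent s σ)` bounds the number of
words of the type of `σ`. -/
lemma sum_exp_neg_wordExponent_le {n : ℕ} (s : Fin n → ℤˣ) :
    ∑ σ : Fin n → ℤˣ, Real.exp (-wordExponent s σ) ≤ ((n : ℝ) + 1) ^ 2 := by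
  have hlt : ∀ (σ : Fin n → ℤˣ) u, negCountOn s σ u < n + 1 := fun σ u =>
    Nat.lt_succ_of_le ((card_le_univ _).trans_eq (Fintype.card_fin n))
  have := sum_prod_le_card_types
    (T := fun (σ : Fin n → ℤˣ) (u : ℤˣ) => (⟨negCountOn s σ u, hlt σ u⟩ : Fin (n + 1)))
    (q := fun t i a => if a = -1 then ((t (s i) : ℕ) : ℝ) / (univ.filter fun j => s j = s i).card
      else 1 - ((t (s i) : ℕ) : ℝ) / (univ.filter fun j => s j = s i).card) ?_ ?_
  · refine le_trans (le_of_eq (sum_congr rfl fun σ _ => ?_)) (this.trans_eq ?_)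
    · rw [← prod_fiberwise univ s, wordExponent, ← sum_neg_distrib, Real.exp_sum]
      refine prod_congr rfl fun u _ => ?_
      rw [← prod_frequency_eq_exp (univ.filter fun i => s i = u) (fun i => σ i = -1)
        (negFraction s σ u) rfl]
      refine prod_congr rfl fun i hi => ?_
      rw [(mem_filter.1 hi).2]
      rfl
    · rw [Fintype.card_fun, Fintype.card_fin, Fintype.card_units_int]
      push_cast
      rfl
  · intro σ i a
    have := negFraction_mem_Icc s σ (s i)
    simp only [negFraction] at this
    dsimp only
    split_ifs
    · exact this.1
    · linarith [this.2]
  · intro σ i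
    rw [UnitsInt.univ, sum_pair (by decide)]
    simp [show (1 : ℤˣ) ≠ -1 by decide]

/-- The fraction of the rows `g a` that have `k` elements. -/
noncomputable def rowFraction {r m : ℕ} (g : Fin m → Finset (Fin r)) (k : ℕ) : ℝ :=
  ((univ.filter fun a => (g a).card = k).card : ℝ) / m

/-- The exponential growth rate, per row, of the number of families of rows of the same type
as `g`. -/
noncomputable def rowExponent {r m : ℕ} (g : Fin m → Finset (Fin r)) : ℝ :=
  ∑ k ∈ range (r + 1),
    (Real.negMulLog (rowFraction g k) + rowFraction g k * Real.log (r.choose k : ℝ))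

lemma card_row_mem_range {r m : ℕ} (g : Fin m → Finset (Fin r)) (a : Fin m) :
    (g a).card ∈ range (r + 1) :=
  mem_range.2 (Nat.lt_succ_of_le ((card_le_univ _).trans_eq (Fintype.card_fin r)))

lemma sum_rowFraction {r m : ℕ} (hm : 0 < m) (g : Fin m → Finset (Fin r)) :
    ∑ k ∈ range (r + 1), rowFraction g k = 1 := by
  have hm' : (m : ℝ) ≠ 0 := by positivity
  have h := card_eq_sum_card_fiberwise (f := fun a => (g a).card) (s := univ)
    (t := range (r + 1)) (fun a _ => card_row_mem_range g a)
  simp only [rowFraction]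
  rw [← sum_div, ← Nat.cast_sum, ← h, card_univ, Fintype.card_fin, div_self hm']

/-- The method of types for families of rows: the rows are independent, the size `k` is chosen with
probability `rowFraction g k` and the row is uniform given its size. -/
lemma sum_exp_neg_rowExponent_le (r m : ℕ) :
    ∑ g : Fin m → Finset (Fin r), Real.exp (-(m * rowExponent g)) ≤ ((m : ℝ) + 1) ^ (r + 1) := by
  rcases Nat.eq_zero_or_pos m with rfl | hm
  · simp
  have hm' : (m : ℝ) ≠ 0 := by positivity
  have hlt : ∀ (g : Fin m → Finset (Fin r)) (k : ℕ),
      (univ.filter fun a => (g a).card = k).card < m + 1 := fun g k =>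
    Nat.lt_succ_of_le ((card_le_univ _).trans_eq (Fintype.card_fin m))
  -- `Fin.ofNat` reduces modulo `r + 1`, which has no effect on the size of a row
  have hof : ∀ k ∈ range (r + 1), (Fin.ofNat (r + 1) k : ℕ) = k := fun k hk =>
    Nat.mod_eq_of_lt (mem_range.1 hk)
  have := sum_prod_le_card_types
    (T := fun (g : Fin m → Finset (Fin r)) (k : Fin (r + 1)) =>
      (⟨(univ.filter fun a => (g a).card = k).card, hlt g k⟩ : Fin (m + 1)))
    (q := fun t _ E => ((t (Fin.ofNat (r + 1) E.card) : ℕ) : ℝ) / m / r.choose E.card) ?_ ?_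
  · refine le_trans (le_of_eq (sum_congr rfl fun g _ => ?_)) (this.trans_eq ?_)
    · dsimp only
      have hq : ∀ a, ((univ.filter fun b =>
            (g b).card = (Fin.ofNat (r + 1) (g a).card : ℕ)).card : ℝ) / m / r.choose (g a).card
          = rowFraction g (g a).card / r.choose (g a).card := fun a => by
        rw [hof _ (card_row_mem_range g a), rowFraction]
      simp only [hq]
      have hch : ∀ a, (0 : ℝ) < r.choose (g a).card := fun a => by
        exact_mod_cast Nat.choose_pos (Nat.lt_succ_iff.1 (mem_range.1 (card_row_mem_range g a)))
      have hpos : ∀ a ∈ (univ : Finset (Fin m)),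
          0 < rowFraction g (g a).card / r.choose (g a).card := by
        intro a _
        have : 0 < (univ.filter fun b => (g b).card = (g a).card).card :=
          card_pos.2 ⟨a, by simp⟩
        have := hch a
        unfold rowFraction
        positivity
      rw [← Real.exp_log (prod_pos hpos), Real.log_prod fun a ha => (hpos a ha).ne']
      congr 1
      rw [← sum_fiberwise_of_maps_to (t := range (r + 1)) (fun a _ => card_row_mem_range g a),
        rowExponent, mul_sum, ← sum_neg_distrib]
      refine sum_congr rfl fun k hk => ?_
      have hck : (r.choose k : ℝ) ≠ 0 := by
        exact_mod_cast (Nat.choose_pos (Nat.lt_succ_iff.1 (mem_range.1 hk))).ne'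
      rw [sum_congr rfl (g := fun _ => Real.log (rowFraction g k / r.choose k))
        fun a ha => by rw [(mem_filter.1 ha).2], sum_const, nsmul_eq_mul]
      have hc : ((univ.filter fun a => (g a).card = k).card : ℝ) = m * rowFraction g k := by
        unfold rowFraction; field_simp
      rw [hc]
      rcases eq_or_ne (rowFraction g k) 0 with h0 | h0
      · simp [h0]
      · rw [Real.log_div h0 hck, Real.negMulLog]; ring
    · simp
  · intro g _ E
    positivity
  · intro g _
    have h := sum_powerset_apply_card (x := (univ : Finset (Fin r)))
      (fun k => ((univ.filter fun a => (g a).card = (Fin.ofNat (r + 1) k : ℕ)).card : ℝ) / m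
        / r.choose k)
    rw [powerset_univ] at h
    dsimp only
    rw [h, card_univ, Fintype.card_fin]
    refine le_of_eq ((sum_congr rfl fun k hk => ?_).trans (sum_rowFraction hm g))
    have hck : (r.choose k : ℝ) ≠ 0 := by
      exact_mod_cast (Nat.choose_pos (Nat.lt_succ_iff.1 (mem_range.1 hk))).ne'
    rw [hof k hk, rowFraction, nsmul_eq_mul]
    field_simp

/-! ### Codewords of a uniform regular graph -/

/-- The parity checks of the graph `Γ` are satisfied by `σ`. -/
def IsCodeword {n m : ℕ} (Γ : Finset (Fin n × Fin m)) (σ : Fin n → ℤˣ) : Prop :=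
  ∀ a, ∏ i ∈ checkNbhd Γ a, σ i = 1

instance {n m : ℕ} (Γ : Finset (Fin n × Fin m)) : DecidablePred (IsCodeword Γ) :=
  fun _ => Fintype.decidableForallFintype

/-- The sockets of each check node which a configuration matches to the entries `-1` of `σ`. -/
def negRows {l r n m : ℕ} (σ : Fin n → ℤˣ) (π : Config l r n m) : Fin m → Finset (Fin r) :=
  fun a => univ.filter fun j => σ (π.symm (a, j)).1 = -1

/-- In a regular graph the sockets of a check node correspond to distinct neighbours, and a parity
check is satisfied iff it involves an even number of entries `-1`. -/
lemma even_card_negRows {l r n m : ℕ} {σ : Fin n → ℤˣ} {π : Config l r n m}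
    (hπ : edgeSet π ∈ regularGraphs l r n m) (hσ : IsCodeword (edgeSet π) σ) (a : Fin m) :
    Even (negRows σ π a).card := by
  have hcard := (mem_regularGraphs.1 hπ).2 a
  have h := hσ a
  rw [checkNbhd_edgeSet] at hcard h
  have hinj : Set.InjOn (fun j => (π.symm (a, j)).1) (univ : Finset (Fin r)) :=
    card_image_iff.1 (by rw [hcard]; simp)
  rw [prod_image hinj] at h
  have hu : ∀ u : ℤˣ, u = if u = -1 then -1 else 1 := by decide
  rw [prod_congr rfl (fun j _ => hu (σ (π.symm (a, j)).1)), prod_ite, prod_const, prod_const_one,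
    mul_one] at h
  by_contra hodd
  rw [Nat.not_even_iff_odd] at hodd
  have h' := hodd.neg_one_pow (α := ℤˣ)
  rw [negRows, h] at h'
  exact absurd h' (by decide)

lemma sum_card_negRows {l r n m : ℕ} (σ : Fin n → ℤˣ) (π : Config l r n m) :
    ∑ a, (negRows σ π a).card = negCount σ * l := by
  have h1 : ∑ a, (negRows σ π a).card
      = ∑ v : Fin m × Fin r, if σ (π.symm v).1 = -1 then 1 else 0 := by
    rw [Fintype.sum_prod_type]
    simp only [negRows, card_filter]
  rw [h1, Equiv.sum_comp π.symm (fun u => if σ u.1 = -1 then 1 else 0), Fintype.sum_prod_type]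
  rw [negCount, card_filter, sum_mul]
  refine sum_congr rfl fun i _ => ?_
  change ∑ _y : Fin l, (if σ i = -1 then 1 else 0) = _
  rw [sum_const, card_univ, Fintype.card_fin, smul_eq_mul, mul_comm]

/-- The number of configurations all of whose rows are even is at most the number of possible
families of rows times the number of configurations with given rows. -/
lemma card_even_config_le {l r n m : ℕ} (σ : Fin n → ℤˣ) :
    (univ.filter fun π : Config l r n m => ∀ a, Even (negRows σ π a).card).card
      ≤ (negCount σ * l).factorial * (n * l - negCount σ * l).factorial *
        (univ.filter fun g : Fin m → Finset (Fin r) =>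
          (∀ a, Even (g a).card) ∧ ∑ a, (g a).card = negCount σ * l).card := by
  refine (card_le_mul_card_image (f := negRows σ) _
    ((negCount σ * l).factorial * (n * l - negCount σ * l).factorial) ?_).trans ?_
  · intro g _
    let A : Finset (Fin n × Fin l) := univ.filter fun u => σ u.1 = -1
    let B : Finset (Fin m × Fin r) := univ.filter fun v => v.2 ∈ g v.1
    have hA : A.card = negCount σ * l := by
      have : A = (univ.filter fun i => σ i = -1) ×ˢ univ := by ext u; simp [A]
      rw [this, card_product]; simp [negCount]
    have h := card_equiv_mapsTo_le A B
    rw [hA, Fintype.card_prod, Fintype.card_fin, Fintype.card_fin] at h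
    refine (card_le_card ?_).trans h
    intro π hπ
    obtain rfl := (mem_filter.1 hπ).2
    simp [A, B, negRows]
  · refine Nat.mul_le_mul_left _ (card_le_card ?_)
    intro g hg
    obtain ⟨π, hπ, rfl⟩ := mem_image.1 hg
    simp only [mem_filter, mem_univ, true_and] at hπ ⊢
    exact ⟨hπ, sum_card_negRows σ π⟩

lemma negCount_le {n : ℕ} (σ : Fin n → ℤˣ) : negCount σ ≤ n :=
  (card_le_univ _).trans_eq (Fintype.card_fin n)

/-- The polynomial factors lost in passing from regular graphs to configurations and in the method
of types. -/
noncomputable def polyFactor (l r n m : ℕ) : ℝ :=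
  2 * ((n * l : ℝ) ^ 2) ^ (8 * l * r) * ((m : ℝ) + 1) ^ (r + 1) * (n * l + 1)

/-- The probability that a given word is a codeword of a uniform regular graph, bounded in terms of
the largest exponent `E` of an even family of rows with the right number of elements. -/
theorem card_isCodeword_le {l r n m : ℕ} (hl : 0 < l) (hr : 0 < r) (hn : 2 * r < n)
    (hN : n * l = m * r) (σ : Fin n → ℤˣ) (E : ℝ)
    (hE : ∀ g : Fin m → Finset (Fin r), (∀ a, Even (g a).card) →
      ∑ a, (g a).card = negCount σ * l → m * rowExponent g ≤ E) :
    (((regularGraphs l r n m).filter fun Γ => IsCodeword Γ σ).card : ℝ)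
      ≤ (regularGraphs l r n m).card * (polyFactor l r n m *
        Real.exp (E - n * l * Real.binEntropy ((negCount σ : ℝ) / n))) := by
  set R := regularGraphs l r n m with hR
  set K := l.factorial ^ n * r.factorial ^ m with hK
  set w := negCount σ * l with hw
  set G := univ.filter fun g : Fin m → Finset (Fin r) =>
          (∀ a, Even (g a).card) ∧ ∑ a, (g a).card = w with hG
  have hKpos : (0 : ℝ) < K := by
    have : 0 < K := by positivity
    exact_mod_cast this
  have hwN : w ≤ n * l := Nat.mul_le_mul_right _ (negCount_le σ)
  -- the fibres of `edgeSet` over the regular graphs all have `K` elements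
  have hfib : ∀ S ⊆ R, S.card * K
      = (univ.filter fun π : Config l r n m => edgeSet π ∈ S).card := by
    intro S hS
    rw [card_eq_sum_card_fiberwise (s := univ.filter fun π : Config l r n m => edgeSet π ∈ S)
      (f := edgeSet) (t := S) (fun π hπ => (mem_filter.1 hπ).2), ← smul_eq_mul, ← sum_const]
    refine sum_congr rfl fun Γ hΓ => ?_
    rw [hK, ← card_edgeSet_eq (hS hΓ), filter_filter]
    congr 1
    ext π
    simp only [mem_filter, mem_univ, true_and]
    exact ⟨fun h => ⟨h ▸ hΓ, h⟩, fun h => h.2⟩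
  have hlow : ((n * l).factorial : ℝ) ≤ 2 * ((n * l : ℝ) ^ 2) ^ (8 * l * r) * (R.card * K) := by
    have h1 := factorial_le_card_simple hl hr hn hN
    have h2 : (univ.filter fun π : Config l r n m => parallelPairs π = ∅).card ≤ R.card * K := by
      rw [hfib R subset_rfl]
      refine card_le_card fun π hπ => ?_
      simp only [mem_filter, mem_univ, true_and] at hπ ⊢
      exact edgeSet_mem_regularGraphs hπ
    have h3 := h1.trans (Nat.mul_le_mul_left _ h2)
    exact_mod_cast h3
  have hup : ((R.filter fun Γ => IsCodeword Γ σ).card : ℝ) * K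
      ≤ (w.factorial * (n * l - w).factorial : ℕ) * G.card := by
    have h1 : (R.filter fun Γ => IsCodeword Γ σ).card * K
        ≤ w.factorial * (n * l - w).factorial * G.card := by
      rw [hfib _ (filter_subset _ _)]
      refine le_trans (card_le_card fun π hπ => ?_) (card_even_config_le σ)
      simp only [mem_filter, mem_univ, true_and] at hπ ⊢
      exact even_card_negRows hπ.1 hπ.2
    exact_mod_cast h1
  have hGcard : (G.card : ℝ) ≤ ((m : ℝ) + 1) ^ (r + 1) * Real.exp E := by
    have h1 : (G.card : ℝ) * Real.exp (-E) ≤ ((m : ℝ) + 1) ^ (r + 1) := by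
      refine le_trans ?_ (sum_exp_neg_rowExponent_le r m)
      rw [← nsmul_eq_mul, ← sum_const]
      refine (sum_le_sum fun g hg => ?_).trans
        (sum_le_univ_sum_of_nonneg fun g => (Real.exp_pos _).le)
      have := (mem_filter.1 hg).2
      exact Real.exp_le_exp.2 (neg_le_neg (hE g this.1 this.2))
    rwa [Real.exp_neg, ← div_eq_mul_inv, div_le_iff₀ (Real.exp_pos _)] at h1
  have hbin : ((w.factorial * (n * l - w).factorial : ℕ) : ℝ)
      ≤ (n * l).factorial * ((n * l + 1) *
        Real.exp (-(n * l * Real.binEntropy ((negCount σ : ℝ) / n)))) := by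
    have h1 := exp_binEntropy_le_choose hwN
    have hdiv : ((w : ℕ) : ℝ) / ((n * l : ℕ) : ℝ) = (negCount σ : ℝ) / n := by
      have : (l : ℝ) ≠ 0 := by positivity
      rw [hw]; push_cast; exact mul_div_mul_right _ _ this
    rw [hdiv] at h1
    push_cast at h1
    have h2 : (((n * l).choose w : ℕ) : ℝ) * ((w.factorial * (n * l - w).factorial : ℕ) : ℝ)
        = (n * l).factorial := by
      rw [← Nat.choose_mul_factorial_mul_factorial hwN]; push_cast; ring
    rw [Real.exp_neg, ← mul_assoc, ← div_eq_mul_inv, le_div_iff₀ (Real.exp_pos _), ← h2]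
    calc _ ≤ ((w.factorial * (n * l - w).factorial : ℕ) : ℝ) *
          ((n * l + 1) * ((n * l).choose w : ℕ)) :=
          mul_le_mul_of_nonneg_left h1 (Nat.cast_nonneg _)
      _ = _ := by ring
  refine le_of_mul_le_mul_right ?_ hKpos
  set ex := Real.exp (-(n * l * Real.binEntropy ((negCount σ : ℝ) / n))) with hex
  have hexp : 0 < ex := Real.exp_pos _
  calc _ ≤ _ := hup
    _ ≤ ((n * l).factorial * ((n * l + 1) * ex)) * (((m : ℝ) + 1) ^ (r + 1) * Real.exp E) :=
        mul_le_mul hbin hGcard (Nat.cast_nonneg _) (by positivity)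
    _ ≤ ((2 * ((n * l : ℝ) ^ 2) ^ (8 * l * r) * (R.card * K)) * ((n * l + 1) * ex)) *
        (((m : ℝ) + 1) ^ (r + 1) * Real.exp E) := by
        gcongr
    _ = _ := by
        rw [polyFactor, sub_eq_add_neg, Real.exp_add]
        ring

/-! ### Exponents and the functions `f` and `k` -/

lemma sum_range_of_odd_eq_zero {r : ℕ} {φ : ℕ → ℝ} (h : ∀ k, Odd k → φ k = 0) :
    ∑ k ∈ range (r + 1), φ k = φ 0 + ∑ t : Fin (r / 2), φ (2 * ((t : ℕ) + 1)) := by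
  rw [Fin.sum_univ_eq_sum_range (fun t => φ (2 * (t + 1))) (r / 2), add_comm (φ 0),
    show φ 0 = φ (2 * 0) from rfl, ← sum_range_succ' (fun t => φ (2 * t)),
    ← sum_image (g := fun t => 2 * t) (s := range (r / 2 + 1)) (f := φ)
      (fun a _ b _ hab => by simpa using hab)]
  symm
  refine sum_subset (fun k hk => ?_) fun k hk hk' => h k ?_
  · simp only [mem_image, mem_range] at hk ⊢
    lia
  · by_contra hodd
    obtain ⟨t, rfl⟩ := (Nat.not_odd_iff_even.1 hodd).two_dvd
    refine hk' (mem_image.2 ⟨t, ?_, rfl⟩)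
    simp only [mem_range] at hk ⊢
    lia

lemma card_filter_eq_neg_one {n : ℕ} (hn : 0 < n) (s : Fin n → ℤˣ) :
    ((univ.filter fun i => s i = -1).card : ℝ) = n * ((negCount s : ℝ) / n) := by
  rw [negCount]; field_simp

lemma card_filter_eq_one {n : ℕ} (hn : 0 < n) (s : Fin n → ℤˣ) :
    ((univ.filter fun i => s i = 1).card : ℝ) = n * (1 - (negCount s : ℝ) / n) := by
  have h := card_filter_add_card_filter_not (s := (univ : Finset (Fin n))) (fun i => s i = -1)
  have hu : ∀ u : ℤˣ, ¬ u = -1 ↔ u = 1 := by decide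
  simp only [hu, card_univ, Fintype.card_fin] at h
  have h' : ((univ.filter fun i => s i = -1).card : ℝ) + (univ.filter fun i => s i = 1).card
      = n := by exact_mod_cast h
  rw [card_filter_eq_neg_one hn] at h'
  linarith

lemma negCountOn_eq_card_mul {n : ℕ} (s σ : Fin n → ℤˣ) (u : ℤˣ) :
    (negCountOn s σ u : ℝ) = (univ.filter fun i => s i = u).card * negFraction s σ u := by
  rcases Nat.eq_zero_or_pos (univ.filter fun i => s i = u).card with h | h
  · have : negCountOn s σ u = 0 := Nat.le_zero.1 ((card_filter_le _ _).trans_eq h)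
    simp [this, h]
  · have : ((univ.filter fun i => s i = u).card : ℝ) ≠ 0 := by positivity
    rw [negFraction, mul_div_cancel₀ _ this]

lemma negCount_eq_add {n : ℕ} (s σ : Fin n → ℤˣ) :
    negCount σ = negCountOn s σ 1 + negCountOn s σ (-1) := by
  have h := card_filter_add_card_filter_not (s := univ.filter fun i => σ i = -1)
    (fun i => s i = 1)
  have hu : ∀ u : ℤˣ, ¬ u = 1 ↔ u = -1 := by decide
  simp only [hu] at h
  rw [negCount, ← h, filter_comm, negCountOn, negCountOn, filter_comm (fun i => σ i = -1)]

lemma negCount_div_eq {n : ℕ} (hn : 0 < n) (s σ : Fin n → ℤˣ) :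
    (negCount σ : ℝ) / n = (1 - (negCount s : ℝ) / n) * negFraction s σ 1
      + (negCount s : ℝ) / n * negFraction s σ (-1) := by
  rw [negCount_eq_add s σ]
  push_cast
  rw [negCountOn_eq_card_mul, negCountOn_eq_card_mul, card_filter_eq_one hn,
    card_filter_eq_neg_one hn]
  field_simp

/-- The row fractions of an even family of rows, in the coordinates `y` of `typeDomain`. -/
noncomputable def evenFractions {r m : ℕ} (g : Fin m → Finset (Fin r)) (t : Fin (r / 2)) : ℝ :=
  rowFraction g (2 * ((t : ℕ) + 1))

lemma rowFraction_of_odd {r m : ℕ} {g : Fin m → Finset (Fin r)} (hg : ∀ a, Even (g a).card)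
    {k : ℕ} (hk : Odd k) : rowFraction g k = 0 := by
  have : (univ.filter fun a => (g a).card = k) = ∅ := by
    refine filter_eq_empty_iff.2 fun a _ h => ?_
    exact Nat.not_even_iff_odd.2 hk (h ▸ hg a)
  simp [rowFraction, this]

/-- The coordinates `y` start at row size `2`; the fraction of empty rows is what they leave. -/
lemma rowFraction_zero {r m : ℕ} (hm : 0 < m) {g : Fin m → Finset (Fin r)}
    (hg : ∀ a, Even (g a).card) : rowFraction g 0 = 1 - ∑ t, evenFractions g t := by
  have h := sum_rowFraction hm g
  rw [sum_range_of_odd_eq_zero fun k => rowFraction_of_odd hg] at h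
  simp only [evenFractions]
  linarith

lemma rowFraction_nonneg {r m : ℕ} (g : Fin m → Finset (Fin r)) (k : ℕ) : 0 ≤ rowFraction g k := by
  unfold rowFraction; positivity

lemma rowFraction_le_one {r m : ℕ} (g : Fin m → Finset (Fin r)) (k : ℕ) : rowFraction g k ≤ 1 :=
  div_le_one_of_le₀ (by exact_mod_cast (card_le_univ _).trans_eq (Fintype.card_fin m))
    (by positivity)

/-- Counting the sockets matched to the entries `-1` of `σ` at both sides shows that the type of
`σ` and of its rows lies in the domain `D(ρ)`, `ρ` being the fraction of flipped bits. -/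
lemma type_mem_typeDomain {l r n m : ℕ} (hl : 0 < l) (hr : 0 < r) (hn : 0 < n)
    (hN : n * l = m * r) (s σ : Fin n → ℤˣ) {g : Fin m → Finset (Fin r)}
    (hg : ∀ a, Even (g a).card) (hsum : ∑ a, (g a).card = negCount σ * l) :
    (negFraction s σ 1, negFraction s σ (-1), evenFractions g)
      ∈ typeDomain r ((negCount s : ℝ) / n) := by
  have hm : 0 < m := Nat.pos_of_mul_pos_right (by rw [← hN]; positivity : 0 < m * r)
  refine ⟨negFraction_mem_Icc s σ 1, negFraction_mem_Icc s σ (-1),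
    fun t => ⟨rowFraction_nonneg _ _, rowFraction_le_one _ _⟩, ?_, ?_⟩
  · have h1 := rowFraction_zero hm hg
    have h2 := rowFraction_nonneg g 0
    dsimp only
    linarith
  · dsimp only
    rw [← negCount_div_eq hn]
    have h1 : ∑ k ∈ range (r + 1), (k : ℝ) / r * rowFraction g k
        = ∑ t : Fin (r / 2), 2 * ((t : ℕ) + 1 : ℝ) / (r : ℝ) * evenFractions g t := by
      rw [sum_range_of_odd_eq_zero fun k hk => by rw [rowFraction_of_odd hg hk, mul_zero]]
      simp [evenFractions]
    have h2 : ∑ k ∈ range (r + 1), k * (univ.filter fun a => (g a).card = k).card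
        = negCount σ * l := by
      rw [← hsum, ← sum_fiberwise_of_maps_to (t := range (r + 1))
        (fun a _ => card_row_mem_range g a)]
      refine sum_congr rfl fun k _ => ?_
      rw [sum_congr rfl (g := fun _ => k) fun a ha => (mem_filter.1 ha).2, sum_const, smul_eq_mul,
        mul_comm]
    have h3 : (∑ k ∈ range (r + 1), (k : ℝ) * (univ.filter fun a => (g a).card = k).card)
        = negCount σ * l := by exact_mod_cast h2
    have h4 : (n : ℝ) * l = m * r := by exact_mod_cast hN
    rw [← h1]
    calc _ = (∑ k ∈ range (r + 1), (k : ℝ) * (univ.filter fun a => (g a).card = k).card)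
          / (m * r) := by
          rw [sum_div]
          refine sum_congr rfl fun k _ => ?_
          rw [rowFraction]; field_simp
      _ = _ := by
          rw [h3, ← h4]
          have : (l : ℝ) ≠ 0 := by positivity
          field_simp

/-- The function `f` is the exponential growth rate of the expected number of codewords. -/
lemma mul_f_eq {l r n m : ℕ} (hl : 0 < l) (hr : 0 < r) (hn : 0 < n) (hN : n * l = m * r)
    (s σ : Fin n → ℤˣ) {g : Fin m → Finset (Fin r)} (hg : ∀ a, Even (g a).card) :
    n * f l r (negFraction s σ 1) (negFraction s σ (-1)) (evenFractions g) ((negCount s : ℝ) / n)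
      = wordExponent s σ + m * rowExponent g
        - n * l * Real.binEntropy ((negCount σ : ℝ) / n) := by
  have hm : 0 < m := Nat.pos_of_mul_pos_right (by rw [← hN]; positivity : 0 < m * r)
  have h4 : (n : ℝ) * (l / r) = m := by
    have : (n : ℝ) * l = m * r := by exact_mod_cast hN
    field_simp
    rw [this, mul_comm]
  have hw : wordExponent s σ = n * ((1 - (negCount s : ℝ) / n) *
      Real.binEntropy (negFraction s σ 1) +
      (negCount s : ℝ) / n * Real.binEntropy (negFraction s σ (-1))) := by
    rw [wordExponent, UnitsInt.univ, sum_pair (by decide), card_filter_eq_one hn,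
      card_filter_eq_neg_one hn]
    ring
  have hrow : rowExponent g = Real.negMulLog (1 - ∑ t, evenFractions g t)
      + ∑ t, Real.negMulLog (evenFractions g t)
      + ∑ t, evenFractions g t * Real.log (r.choose (2 * ((t : ℕ) + 1)) : ℝ) := by
    rw [rowExponent, sum_range_of_odd_eq_zero fun k hk => by simp [rowFraction_of_odd hg hk],
      rowFraction_zero hm hg, sum_add_distrib]
    simp [evenFractions, add_assoc]
  rw [hw, hrow, f, ← negCount_div_eq hn, ← h4]
  ring

lemma mul_k_eq {n : ℕ} (hn : 0 < n) (p : ℝ) (s σ : Fin n → ℤˣ) :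
    n * k (negFraction s σ 1) (negFraction s σ (-1)) ((negCount s : ℝ) / n) p
      = ((negCountOn s σ (-1) : ℝ) - negCountOn s σ 1) * Real.log ((1 - p) / p) := by
  rw [negCountOn_eq_card_mul, negCountOn_eq_card_mul, card_filter_eq_one hn,
    card_filter_eq_neg_one hn, k]
  ring

/-- By compactness the exponent stays bounded away from `0` on the words of weight at least `δ n`,
also if the fraction `ρ` of flipped bits deviates slightly from `p`. -/
theorem exists_exponent_gap {l r : ℕ} {p : ℝ}
    (hmax : argmax (fun z : ℝ × ℝ × (Fin (r / 2) → ℝ) => f l r z.1 z.2.1 z.2.2 p + k z.1 z.2.1 p p)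
      (typeDomain r p) = {(0, 0, 0)}) {δ : ℝ} (hδ : 0 < δ) :
    ∃ c > 0, ∀ ρ, |ρ - p| < c → ∀ z ∈ typeDomain r ρ, δ ≤ (1 - ρ) * z.1 + ρ * z.2.1 →
      f l r z.1 z.2.1 z.2.2 ρ + k z.1 z.2.1 ρ p ≤ -c := by
  let F : ℝ × ℝ × ℝ × (Fin (r / 2) → ℝ) → ℝ :=
    fun w => f l r w.2.1 w.2.2.1 w.2.2.2 w.1 + k w.2.1 w.2.2.1 w.1 p
  have hF : Continuous F := by
    have h1 := Real.binEntropy_continuous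
    have h2 := Real.continuous_negMulLog
    simp only [F, f, k]
    fun_prop
  let T : Set (ℝ × ℝ × ℝ × (Fin (r / 2) → ℝ)) :=
    {w | w.1 ∈ Set.Icc (p - 1) (p + 1) ∧ w.2 ∈ typeDomain r w.1 ∧
      δ ≤ (1 - w.1) * w.2.1 + w.1 * w.2.2.1}
  have hTclosed : IsClosed T := by
    have e : T = {w | w.1 ∈ Set.Icc (p - 1) (p + 1)} ∩ ({w | w.2.1 ∈ Set.Icc (0 : ℝ) 1} ∩
        ({w | w.2.2.1 ∈ Set.Icc (0 : ℝ) 1} ∩ ((⋂ t, {w | w.2.2.2 t ∈ Set.Icc (0 : ℝ) 1}) ∩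
        ({w | ∑ t, w.2.2.2 t ≤ 1} ∩
        ({w | ∑ t : Fin (r / 2), 2 * ((t : ℕ) + 1 : ℝ) / (r : ℝ) * w.2.2.2 t
          = (1 - w.1) * w.2.1 + w.1 * w.2.2.1} ∩
        {w | δ ≤ (1 - w.1) * w.2.1 + w.1 * w.2.2.1}))))) := by
      ext w
      simp only [T, typeDomain, Set.mem_ofPred_eq, Set.mem_inter_iff, Set.mem_iInter]
      tauto
    rw [e]
    refine (isClosed_Icc.preimage (by fun_prop)).inter <|
      (isClosed_Icc.preimage (by fun_prop)).inter <|
      (isClosed_Icc.preimage (by fun_prop)).inter <|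
      (isClosed_iInter fun t => isClosed_Icc.preimage (by fun_prop)).inter <|
      (isClosed_le (by fun_prop) (by fun_prop)).inter <|
      (isClosed_eq (by fun_prop) (by fun_prop)).inter (isClosed_le (by fun_prop) (by fun_prop))
  have hTcompact : IsCompact T := by
    refine (isCompact_Icc.prod (isCompact_Icc.prod (isCompact_Icc.prod
      (isCompact_univ_pi fun _ => isCompact_Icc)))).of_isClosed_subset hTclosed
      (s := Set.Icc (p - 1) (p + 1) ×ˢ Set.Icc (0 : ℝ) 1 ×ˢ Set.Icc (0 : ℝ) 1 ×ˢ
        Set.univ.pi fun _ => Set.Icc (0 : ℝ) 1) ?_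
    rintro w ⟨h1, ⟨h2, h3, h4, -⟩, -⟩
    exact ⟨h1, h2, h3, fun t _ => h4 t⟩
  -- `G > 0` on `T`: where `ρ = p`, the exponent `F` is negative
  let G : ℝ × ℝ × ℝ × (Fin (r / 2) → ℝ) → ℝ := fun w => max |w.1 - p| (-F w)
  have hGpos : ∀ w ∈ T, 0 < G w := by
    rintro ⟨ρ, z⟩ ⟨-, hz, hzδ⟩
    rcases eq_or_ne ρ p with rfl | hne
    · refine lt_max_of_lt_right (neg_pos.2 ?_)
      have h0 : ((0, 0, 0) : ℝ × ℝ × (Fin (r / 2) → ℝ)) ∈ argmax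
          (fun z : ℝ × ℝ × (Fin (r / 2) → ℝ) => f l r z.1 z.2.1 z.2.2 ρ + k z.1 z.2.1 ρ ρ)
          (typeDomain r ρ) := by rw [hmax]; rfl
      have hval : f l r 0 0 (0 : Fin (r / 2) → ℝ) ρ + k 0 0 ρ ρ = 0 := by
        simp [f, k]
      have hle : F (ρ, z) ≤ 0 := (h0.2 z hz).trans_eq hval
      refine lt_of_le_of_ne hle fun heq => ?_
      have hz' : z ∈ argmax
          (fun z : ℝ × ℝ × (Fin (r / 2) → ℝ) => f l r z.1 z.2.1 z.2.2 ρ + k z.1 z.2.1 ρ ρ)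
          (typeDomain r ρ) :=
        ⟨hz, fun w hw => (h0.2 w hw).trans_eq (hval.trans heq.symm)⟩
      rw [hmax, Set.mem_singleton_iff] at hz'
      subst hz'
      simp at hzδ
      linarith
    · exact lt_max_of_lt_left (abs_pos.2 (sub_ne_zero.2 hne))
  have hG : Continuous G := by fun_prop
  obtain ⟨c, hc0, hc1, hc⟩ : ∃ c > 0, c ≤ 1 ∧ ∀ w ∈ T, c ≤ G w := by
    rcases T.eq_empty_or_nonempty with h | h
    · exact ⟨1, one_pos, le_rfl, by simp [h]⟩
    · obtain ⟨w, hw, hmin⟩ := hTcompact.exists_isMinOn h hG.continuousOn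
      exact ⟨min 1 (G w), lt_min one_pos (hGpos w hw), min_le_left _ _,
        fun w' hw' => (min_le_right _ _).trans (hmin hw')⟩
  refine ⟨c, hc0, fun ρ hρ z hz hzδ => ?_⟩
  have hρ' := abs_lt.1 hρ
  have hmem : (ρ, z) ∈ T := ⟨⟨by linarith, by linarith⟩, hz, hzδ⟩
  rcases le_max_iff.1 (hc _ hmem) with h | h
  · exact absurd hρ (not_lt.2 h)
  · have : c ≤ -(f l r z.1 z.2.1 z.2.2 ρ + k z.1 z.2.1 ρ p) := h
    linarith

/-! ### The channel and the posterior -/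

lemma bsc_pos {p : ℝ} (h0 : 0 < p) (h1 : p < 1) (s σ : ℤˣ) : 0 < bsc p s σ := by
  unfold bsc
  split_ifs <;> linarith

lemma sum_bsc_one (p : ℝ) : ∑ u : ℤˣ, bsc p u 1 = 1 := by
  rw [UnitsInt.univ, sum_pair (by decide), bsc, bsc, if_pos rfl, if_neg (by decide)]
  ring

lemma sum_prod_bsc_one (n : ℕ) (p : ℝ) : ∑ s : Fin n → ℤˣ, ∏ i, bsc p (s i) 1 = 1 := by
  have h := prod_univ_sum (fun _ : Fin n => (univ : Finset ℤˣ)) (fun _ u => bsc p u 1)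
  rw [Fintype.piFinset_univ] at h
  rw [← h]
  exact prod_eq_one fun _ _ => sum_bsc_one p

/-- The number of flipped bits has variance at most `n`. -/
lemma outputExpect_sq_le (n : ℕ) {p : ℝ} (h0 : 0 < p) (h1 : p < 1) :
    outputExpect n p (fun s => ((negCount s : ℝ) - n * p) ^ 2) ≤ n := by
  let φ : ℤˣ → ℝ := fun u => (if u = -1 then 1 else 0) - p
  have hφ : ∑ u, bsc p u 1 * φ u = 0 := by
    rw [UnitsInt.univ, sum_pair (by decide), bsc, bsc, if_pos rfl, if_neg (by decide)]
    simp only [φ, if_neg (show (1 : ℤˣ) ≠ -1 by decide), if_true]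
    ring
  have hφ1 : ∀ u, |φ u| ≤ 1 := by
    intro u
    simp only [φ]
    split_ifs <;> rw [abs_le] <;> constructor <;> linarith
  have hcount : ∀ s : Fin n → ℤˣ, (negCount s : ℝ) - n * p = ∑ i, φ (s i) := by
    intro s
    simp [φ, negCount, sum_sub_distrib]
  -- distinct positions are uncorrelated: the factor at `i` of the product over positions vanishes
  have hcov : ∀ i j : Fin n, ∑ s : Fin n → ℤˣ, (∏ i, bsc p (s i) 1) * (φ (s i) * φ (s j))
      ≤ if i = j then 1 else 0 := by
    intro i j
    split_ifs with hij
    · rw [← sum_prod_bsc_one n p]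
      refine sum_le_sum fun s _ => mul_le_of_le_one_right
        (prod_nonneg fun _ _ => (bsc_pos h0 h1 _ _).le) ?_
      exact (le_abs_self _).trans (by rw [abs_mul]; exact mul_le_one₀ (hφ1 _) (abs_nonneg _) (hφ1 _))
    · have h := prod_univ_sum (fun _ : Fin n => (univ : Finset ℤˣ)) (fun a u =>
        bsc p u 1 * ((if a = i then φ u else 1) * (if a = j then φ u else 1)))
      rw [Fintype.piFinset_univ, prod_eq_zero (mem_univ i) (by simpa [hij] using hφ)] at h
      refine le_of_eq ?_
      rw [h]
      refine sum_congr rfl fun s _ => ?_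
      rw [prod_mul_distrib, prod_mul_distrib]
      simp
  calc outputExpect n p (fun s => ((negCount s : ℝ) - n * p) ^ 2)
      = ∑ i, ∑ j, ∑ s : Fin n → ℤˣ, (∏ i, bsc p (s i) 1) * (φ (s i) * φ (s j)) := by
        have hsq : ∀ s : Fin n → ℤˣ,
            ((negCount s : ℝ) - n * p) ^ 2 = ∑ i, ∑ j, φ (s i) * φ (s j) := fun s => by
          rw [hcount, sq, sum_mul_sum]
        rw [outputExpect]
        simp only [hsq, mul_sum]
        rw [sum_comm]
        exact sum_congr rfl fun i _ => sum_comm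
    _ ≤ ∑ i : Fin n, ∑ j : Fin n, if i = j then 1 else 0 :=
        sum_le_sum fun i _ => sum_le_sum fun j _ => hcov i j
    _ = n := by simp

/-- Chebyshev's inequality for the fraction of flipped bits. -/
lemma outputExpect_atypical_le {n : ℕ} (hn : 0 < n) {p : ℝ} (h0 : 0 < p) (h1 : p < 1) {c : ℝ}
    (hc : 0 < c) :
    outputExpect n p (fun s => if |(negCount s : ℝ) / n - p| < c then 0 else 1)
      ≤ 1 / (n * c ^ 2) := by
  have hn' : (0 : ℝ) < n := by exact_mod_cast hn
  have h : outputExpect n p (fun s => if |(negCount s : ℝ) / n - p| < c then 0 else 1)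
      ≤ outputExpect n p (fun s => ((negCount s : ℝ) - n * p) ^ 2) / (n * c) ^ 2 := by
    rw [outputExpect, outputExpect, sum_div]
    refine sum_le_sum fun s _ => ?_
    rw [mul_div_assoc]
    refine mul_le_mul_of_nonneg_left ?_ (prod_nonneg fun _ _ => (bsc_pos h0 h1 _ _).le)
    split_ifs with hs
    · positivity
    · rw [one_le_div (by positivity), ← sq_abs ((negCount s : ℝ) - n * p)]
      have : (negCount s : ℝ) - n * p = n * ((negCount s : ℝ) / n - p) := by field_simp
      rw [this, abs_mul, abs_of_pos hn']
      gcongr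
      exact not_lt.1 hs
  refine h.trans ?_
  rw [div_le_div_iff₀ (by positivity) (by positivity)]
  have := outputExpect_sq_le n h0 h1
  calc _ ≤ (n : ℝ) * (n * c ^ 2) := by gcongr
    _ = _ := by ring

lemma weight_eq {n m : ℕ} (Γ : Finset (Fin n × Fin m)) (p : ℝ) (s σ : Fin n → ℤˣ) :
    weight Γ p s σ = if IsCodeword Γ σ then ∏ i, bsc p (s i) (σ i) else 0 := by
  have hcast : ∀ a, ∏ i ∈ checkNbhd Γ a, ((σ i : ℤ) : ℝ)
      = (((∏ i ∈ checkNbhd Γ a, σ i : ℤˣ) : ℤ) : ℝ) := fun a => by push_cast; rfl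
  unfold weight
  split_ifs with h
  · rw [prod_eq_one, one_mul]
    intro a _
    rw [hcast, h a]
    norm_num
  · obtain ⟨a, ha⟩ := not_forall.1 h
    rw [prod_eq_zero (mem_univ a), zero_mul]
    rw [hcast, (Int.units_eq_one_or _).resolve_left ha]
    norm_num

lemma weight_nonneg {n m : ℕ} (Γ : Finset (Fin n × Fin m)) {p : ℝ} (h0 : 0 < p) (h1 : p < 1)
    (s σ : Fin n → ℤˣ) : 0 ≤ weight Γ p s σ := by
  rw [weight_eq]
  split_ifs
  · exact prod_nonneg fun _ _ => (bsc_pos h0 h1 _ _).le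
  · exact le_rfl

lemma weight_one {n m : ℕ} (Γ : Finset (Fin n × Fin m)) (p : ℝ) (s : Fin n → ℤˣ) :
    weight Γ p s 1 = ∏ i, bsc p (s i) 1 := by
  rw [weight_eq, if_pos (show IsCodeword Γ 1 from fun a => prod_eq_one fun _ _ => rfl)]
  rfl

lemma prod_bsc_one_le_partitionFunction {n m : ℕ} (Γ : Finset (Fin n × Fin m)) {p : ℝ}
    (h0 : 0 < p) (h1 : p < 1) (s : Fin n → ℤˣ) :
    ∏ i, bsc p (s i) 1 ≤ partitionFunction Γ p s := by
  rw [← weight_one Γ p s]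
  exact single_le_sum (fun σ _ => weight_nonneg Γ h0 h1 s σ) (mem_univ _)

lemma partitionFunction_pos {n m : ℕ} (Γ : Finset (Fin n × Fin m)) {p : ℝ}
    (h0 : 0 < p) (h1 : p < 1) (s : Fin n → ℤˣ) : 0 < partitionFunction Γ p s :=
  (prod_pos fun _ _ => bsc_pos h0 h1 _ _).trans_le (prod_bsc_one_le_partitionFunction Γ h0 h1 s)

lemma posterior_nonneg {n m : ℕ} (Γ : Finset (Fin n × Fin m)) {p : ℝ} (h0 : 0 < p) (h1 : p < 1)
    (s σ : Fin n → ℤˣ) : 0 ≤ posterior Γ p s σ :=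
  div_nonneg (weight_nonneg Γ h0 h1 s σ) (partitionFunction_pos Γ h0 h1 s).le

lemma sum_posterior {n m : ℕ} (Γ : Finset (Fin n × Fin m)) {p : ℝ} (h0 : 0 < p) (h1 : p < 1)
    (s : Fin n → ℤˣ) : ∑ σ, posterior Γ p s σ = 1 := by
  simp only [posterior]
  rw [← sum_div]
  exact div_self (partitionFunction_pos Γ h0 h1 s).ne'

/-- The likelihood ratio of `σ` with respect to the transmitted codeword. -/
lemma prod_bsc_eq {n : ℕ} {p : ℝ} (h0 : 0 < p) (h1 : p < 1) (s σ : Fin n → ℤˣ) :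
    ∏ i, bsc p (s i) (σ i) = (∏ i, bsc p (s i) 1) *
      Real.exp (((negCountOn s σ (-1) : ℝ) - negCountOn s σ 1) * Real.log ((1 - p) / p)) := by
  set L := Real.log ((1 - p) / p) with hL
  have h1p : 0 < 1 - p := by linarith
  have hexp : Real.exp L = (1 - p) / p := Real.exp_log (by positivity)
  have hon : ∀ u, (negCountOn s σ u : ℝ) = ∑ i, if s i = u ∧ σ i = -1 then 1 else 0 := by
    intro u
    rw [negCountOn, filter_filter, sum_boole]
  rw [hon, hon, ← sum_sub_distrib, sum_mul, Real.exp_sum, ← prod_mul_distrib]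
  refine prod_congr rfl fun i _ => ?_
  have h11 : (1 : ℤˣ) ≠ -1 := by decide
  rcases Int.units_eq_one_or (s i) with hs | hs <;> rcases Int.units_eq_one_or (σ i) with hσ | hσ <;>
    simp [hs, hσ, bsc, h11, h11.symm, Real.exp_neg, hexp] <;> field_simp

/-- The posterior probability is bounded by the likelihood ratio with respect to the transmitted
codeword. -/
lemma posterior_le {n m : ℕ} (Γ : Finset (Fin n × Fin m)) {p : ℝ} (h0 : 0 < p) (h1 : p < 1)
    (s σ : Fin n → ℤˣ) :
    posterior Γ p s σ ≤ if IsCodeword Γ σ then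
      Real.exp (((negCountOn s σ (-1) : ℝ) - negCountOn s σ 1) * Real.log ((1 - p) / p)) else 0 := by
  have hpos : 0 < ∏ i, bsc p (s i) 1 := prod_pos fun _ _ => bsc_pos h0 h1 _ _
  rw [posterior, weight_eq]
  split_ifs with h
  · rw [prod_bsc_eq h0 h1, div_le_iff₀ (partitionFunction_pos Γ h0 h1 s), mul_comm]
    exact mul_le_mul_of_nonneg_left (prod_bsc_one_le_partitionFunction Γ h0 h1 s)
      (Real.exp_pos _).le
  · simp

/-- The bit-error probability is the expected fraction of entries `-1` of a word drawn from the
posterior. -/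
lemma bitErrorProb_eq {n m : ℕ} (hn : 0 < n) (Γ : Finset (Fin n × Fin m)) {p : ℝ} (h0 : 0 < p)
    (h1 : p < 1) :
    bitErrorProb Γ p
      = outputExpect n p fun s => ∑ σ, posterior Γ p s σ * ((negCount σ : ℝ) / n) := by
  have hn' : (n : ℝ) ≠ 0 := by positivity
  have hu : ∀ u : ℤˣ, ((u : ℤ) : ℝ) = 1 - 2 * (if u = -1 then 1 else 0) := by
    intro u
    rcases Int.units_eq_one_or u with rfl | rfl
    · simp [show (1 : ℤˣ) ≠ -1 by decide]
    · norm_num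
  have hσ : ∀ σ : Fin n → ℤˣ, ∑ i, ((σ i : ℤ) : ℝ) = n - 2 * negCount σ := by
    intro σ
    simp only [hu]
    rw [sum_sub_distrib, ← mul_sum, sum_boole]
    simp [negCount]
  have hmag : ∀ s : Fin n → ℤˣ, 1 / (n : ℝ) * ∑ i, magnetization Γ p s i
      = 1 - 2 * ∑ σ, posterior Γ p s σ * ((negCount σ : ℝ) / n) := by
    intro s
    simp only [magnetization]
    rw [sum_comm]
    simp only [← mul_sum, hσ]
    calc 1 / (n : ℝ) * ∑ σ, posterior Γ p s σ * (n - 2 * negCount σ)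
        = ∑ σ, posterior Γ p s σ - 2 * ∑ σ, posterior Γ p s σ * ((negCount σ : ℝ) / n) := by
          rw [mul_sum, mul_sum, ← sum_sub_distrib]
          refine sum_congr rfl fun σ _ => ?_
          field_simp
      _ = _ := by rw [sum_posterior Γ h0 h1 s]
  rw [bitErrorProb, outputExpect, outputExpect]
  simp only [hmag, mul_sub, mul_one, sum_sub_distrib, sum_prod_bsc_one]
  simp only [mul_left_comm _ (2 : ℝ), ← mul_sum]
  ring

lemma outputExpect_mono {n : ℕ} {p : ℝ} (h0 : 0 < p) (h1 : p < 1) {X Y : (Fin n → ℤˣ) → ℝ}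
    (h : ∀ s, X s ≤ Y s) : outputExpect n p X ≤ outputExpect n p Y :=
  sum_le_sum fun s _ => mul_le_mul_of_nonneg_left (h s)
    (prod_nonneg fun _ _ => (bsc_pos h0 h1 _ _).le)

lemma outputExpect_add {n : ℕ} {p : ℝ} (X Y : (Fin n → ℤˣ) → ℝ) :
    outputExpect n p (fun s => X s + Y s) = outputExpect n p X + outputExpect n p Y := by
  simp only [outputExpect, mul_add, sum_add_distrib]

lemma outputExpect_const (n : ℕ) (p c : ℝ) : outputExpect n p (fun _ => c) = c := by
  rw [outputExpect, ← sum_mul, sum_prod_bsc_one, one_mul]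

lemma bitErrorProb_nonneg {n m : ℕ} (hn : 0 < n) (Γ : Finset (Fin n × Fin m)) {p : ℝ} (h0 : 0 < p)
    (h1 : p < 1) : 0 ≤ bitErrorProb Γ p := by
  rw [bitErrorProb_eq hn Γ h0 h1, ← outputExpect_const n p 0]
  exact outputExpect_mono h0 h1 fun s => sum_nonneg fun σ _ =>
    mul_nonneg (posterior_nonneg Γ h0 h1 s σ) (by positivity)

/-! ### The first moment bound -/

/-- The sum of the likelihood ratios of the codewords of weight at least `δ n`. -/
noncomputable def heavySum {n m : ℕ} (Γ : Finset (Fin n × Fin m)) (p δ : ℝ) (s : Fin n → ℤˣ) : ℝ :=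
  ∑ σ : Fin n → ℤˣ with δ ≤ (negCount σ : ℝ) / n, if IsCodeword Γ σ then
    Real.exp (((negCountOn s σ (-1) : ℝ) - negCountOn s σ 1) * Real.log ((1 - p) / p)) else 0

/-- Light words contribute at most `δ` to the bit-error probability. -/
lemma sum_posterior_mul_le {n m : ℕ} (Γ : Finset (Fin n × Fin m)) {p δ : ℝ}
    (h0 : 0 < p) (h1 : p < 1) (hδ : 0 < δ) (s : Fin n → ℤˣ) :
    ∑ σ, posterior Γ p s σ * ((negCount σ : ℝ) / n) ≤ δ + heavySum Γ p δ s := by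
  have hle : ∀ σ : Fin n → ℤˣ, (negCount σ : ℝ) / n ≤ 1 := fun σ =>
    div_le_one_of_le₀ (by exact_mod_cast negCount_le σ) (by positivity)
  rw [← sum_filter_not_add_sum_filter univ (fun σ : Fin n → ℤˣ => δ ≤ (negCount σ : ℝ) / n)]
  refine add_le_add ?_ (sum_le_sum fun σ _ => ?_)
  · calc _ ≤ ∑ σ : Fin n → ℤˣ with ¬ δ ≤ (negCount σ : ℝ) / n, posterior Γ p s σ * δ :=
          sum_le_sum fun σ hσ => mul_le_mul_of_nonneg_left (not_le.1 (mem_filter.1 hσ).2).le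
            (posterior_nonneg Γ h0 h1 s σ)
      _ ≤ ∑ σ, posterior Γ p s σ * δ :=
          sum_le_univ_sum_of_nonneg fun σ => mul_nonneg (posterior_nonneg Γ h0 h1 s σ) hδ.le
      _ = δ := by rw [← sum_mul, sum_posterior Γ h0 h1, one_mul]
  · exact (mul_le_of_le_one_right (posterior_nonneg Γ h0 h1 s σ) (hle σ)).trans
      (posterior_le Γ h0 h1 s σ)

/-- For a typical channel output, the heavy codewords have exponentially small total likelihood
ratio on average over the graph. -/
lemma sum_heavySum_le {l r n m : ℕ} (hl : 0 < l) (hr : 0 < r) (hn : 2 * r < n)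
    (hN : n * l = m * r) {p δ c : ℝ}
    (hgap : ∀ ρ, |ρ - p| < c → ∀ z ∈ typeDomain r ρ, δ ≤ (1 - ρ) * z.1 + ρ * z.2.1 →
      f l r z.1 z.2.1 z.2.2 ρ + k z.1 z.2.1 ρ p ≤ -c)
    {s : Fin n → ℤˣ} (hs : |(negCount s : ℝ) / n - p| < c) :
    ∑ Γ ∈ regularGraphs l r n m, heavySum Γ p δ s
      ≤ (regularGraphs l r n m).card *
        (polyFactor l r n m * ((n : ℝ) + 1) ^ 2 * Real.exp (-(n * c))) := by
  have hn0 : 0 < n := by lia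
  have hpoly : 0 ≤ polyFactor l r n m := by unfold polyFactor; positivity
  set R := regularGraphs l r n m with hR
  let b : (Fin n → ℤˣ) → ℝ := fun σ =>
    ((negCountOn s σ (-1) : ℝ) - negCountOn s σ 1) * Real.log ((1 - p) / p)
  have hterm : ∀ σ : Fin n → ℤˣ, δ ≤ (negCount σ : ℝ) / n →
      ((R.filter fun Γ => IsCodeword Γ σ).card : ℝ) * Real.exp (b σ)
        ≤ R.card * (polyFactor l r n m * Real.exp (-(n * c))) * Real.exp (-wordExponent s σ) := by
    intro σ hσ
    have h := card_isCodeword_le hl hr hn hN σ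
      (-(n * c) - wordExponent s σ - b σ + n * l * Real.binEntropy ((negCount σ : ℝ) / n)) ?_
    · rw [add_sub_cancel_right, ← hR] at h
      refine (mul_le_mul_of_nonneg_right h (Real.exp_pos _).le).trans (le_of_eq ?_)
      rw [show -(n * c) - wordExponent s σ - b σ = -(n * c) + -wordExponent s σ + -b σ by ring,
        Real.exp_add, Real.exp_add, Real.exp_neg (b σ)]
      have := (Real.exp_pos (b σ)).ne'
      field_simp
    · intro g hg hsum
      have h1 := hgap _ hs _ (type_mem_typeDomain hl hr hn0 hN s σ hg hsum)
        (by rw [← negCount_div_eq hn0]; exact hσ)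
      have h2 := mul_f_eq hl hr hn0 hN s σ hg
      have h3 : _ = b σ := mul_k_eq hn0 p s σ
      have h4 := mul_le_mul_of_nonneg_left h1 (Nat.cast_nonneg (α := ℝ) n)
      dsimp only at h4
      rw [mul_add, h2, h3] at h4
      linarith
  calc ∑ Γ ∈ R, heavySum Γ p δ s
      = ∑ σ : Fin n → ℤˣ with δ ≤ (negCount σ : ℝ) / n,
          ((R.filter fun Γ => IsCodeword Γ σ).card : ℝ) * Real.exp (b σ) := by
        simp only [heavySum]
        rw [sum_comm]
        refine sum_congr rfl fun σ _ => ?_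
        rw [← sum_filter, sum_const, nsmul_eq_mul]
    _ ≤ ∑ σ : Fin n → ℤˣ with δ ≤ (negCount σ : ℝ) / n,
          R.card * (polyFactor l r n m * Real.exp (-(n * c))) * Real.exp (-wordExponent s σ) :=
        sum_le_sum fun σ hσ => hterm σ (mem_filter.1 hσ).2
    _ ≤ ∑ σ : Fin n → ℤˣ,
          R.card * (polyFactor l r n m * Real.exp (-(n * c))) * Real.exp (-wordExponent s σ) :=
        sum_le_univ_sum_of_nonneg fun σ => by positivity
    _ ≤ R.card * (polyFactor l r n m * Real.exp (-(n * c))) * ((n : ℝ) + 1) ^ 2 := by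
        rw [← mul_sum]
        exact mul_le_mul_of_nonneg_left (sum_exp_neg_wordExponent_le s) (by positivity)
    _ = _ := by ring

/-- The three error terms come from atypical channel outputs, from light words and from heavy
codewords. -/
theorem sum_bitErrorProb_le {l r n m : ℕ} (hl : 0 < l) (hr : 0 < r) (hn : 2 * r < n)
    (hN : n * l = m * r) {p δ c : ℝ} (h0 : 0 < p) (h1 : p < 1) (hδ : 0 < δ) (hc : 0 < c)
    (hgap : ∀ ρ, |ρ - p| < c → ∀ z ∈ typeDomain r ρ, δ ≤ (1 - ρ) * z.1 + ρ * z.2.1 →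
      f l r z.1 z.2.1 z.2.2 ρ + k z.1 z.2.1 ρ p ≤ -c) :
    ∑ Γ ∈ regularGraphs l r n m, bitErrorProb Γ p
      ≤ (regularGraphs l r n m).card * (1 / (n * c ^ 2) + δ +
        polyFactor l r n m * ((n : ℝ) + 1) ^ 2 * Real.exp (-(n * c))) := by
  have hn0 : 0 < n := by lia
  have hpoly : 0 ≤ polyFactor l r n m := by unfold polyFactor; positivity
  set R := regularGraphs l r n m
  set Q := polyFactor l r n m * ((n : ℝ) + 1) ^ 2 * Real.exp (-(n * c)) with hQ
  have hQ0 : 0 ≤ Q := by positivity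
  let atyp : (Fin n → ℤˣ) → ℝ := fun s => if |(negCount s : ℝ) / n - p| < c then 0 else 1
  have hpt : ∀ s : Fin n → ℤˣ,
      ∑ Γ ∈ R, ∑ σ, posterior Γ p s σ * ((negCount σ : ℝ) / n)
        ≤ R.card * atyp s + R.card * (δ + Q) := by
    intro s
    by_cases hs : |(negCount s : ℝ) / n - p| < c
    · have h := sum_heavySum_le hl hr hn hN hgap hs
      calc _ ≤ ∑ Γ ∈ R, (δ + heavySum Γ p δ s) :=
            sum_le_sum fun Γ _ => sum_posterior_mul_le Γ h0 h1 hδ s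
        _ ≤ R.card * δ + R.card * Q := by
            rw [sum_add_distrib, sum_const, nsmul_eq_mul]
            exact add_le_add le_rfl h
        _ = _ := by simp only [atyp, if_pos hs]; ring
    · have hle : ∀ Γ ∈ R, ∑ σ, posterior Γ p s σ * ((negCount σ : ℝ) / n) ≤ 1 := by
        intro Γ _
        rw [← sum_posterior Γ h0 h1 s]
        exact sum_le_sum fun σ _ => mul_le_of_le_one_right (posterior_nonneg Γ h0 h1 s σ)
          (div_le_one_of_le₀ (by exact_mod_cast negCount_le σ) (by positivity))
      calc _ ≤ R.card * (1 : ℝ) := by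
            rw [← nsmul_eq_mul, ← sum_const]; exact sum_le_sum hle
        _ ≤ _ := by
            simp only [atyp, if_neg hs]
            exact le_add_of_nonneg_right (by positivity)
  calc ∑ Γ ∈ R, bitErrorProb Γ p
      = outputExpect n p fun s => ∑ Γ ∈ R, ∑ σ, posterior Γ p s σ * ((negCount σ : ℝ) / n) := by
        rw [sum_congr rfl fun Γ _ => bitErrorProb_eq hn0 Γ h0 h1]
        simp only [outputExpect]
        rw [sum_comm]
        simp only [mul_sum]
    _ ≤ outputExpect n p fun s => R.card * atyp s + R.card * (δ + Q) := outputExpect_mono h0 h1 hpt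
    _ = R.card * outputExpect n p atyp + R.card * (δ + Q) := by
        rw [outputExpect_add, outputExpect_const, outputExpect, outputExpect, mul_sum]
        simp only [mul_left_comm]
    _ ≤ R.card * (1 / (n * c ^ 2)) + R.card * (δ + Q) := by
        gcongr
        exact outputExpect_atypical_le hn0 h0 h1 hc
    _ = _ := by ring

/-- The exponential decay beats the polynomial factors. -/
lemma exists_polyFactor_le {l r : ℕ} (hl : 0 < l) (hr : 0 < r) {c : ℝ} (hc : 0 < c) :
    ∃ B : ℕ → ℝ, Filter.Tendsto B Filter.atTop (nhds 0) ∧ ∀ n m : ℕ, n * l = m * r →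
      polyFactor l r n m * ((n : ℝ) + 1) ^ 2 * Real.exp (-(n * c)) ≤ B n := by
  set K := 2 * (8 * l * r) + (r + 1) + 1 + 2 with hK
  refine ⟨fun n => 2 * (l / c) ^ K * Real.exp c *
    ((c * ((n : ℝ) + 1)) ^ K * Real.exp (-(c * ((n : ℝ) + 1)))), ?_, ?_⟩
  · have hlin : Filter.Tendsto (fun n : ℕ => c * ((n : ℝ) + 1)) Filter.atTop Filter.atTop :=
      (Filter.tendsto_atTop_add_const_right _ _ tendsto_natCast_atTop_atTop).const_mul_atTop hc
    have := ((Real.tendsto_pow_mul_exp_neg_atTop_nhds_zero K).comp hlin).const_mul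
      (2 * (l / c) ^ K * Real.exp c)
    simpa using this
  · intro n m hN
    have hl1 : (1 : ℝ) ≤ l := by exact_mod_cast hl
    have hmN : (m : ℝ) ≤ n * l := by
      have : m ≤ n * l := hN ▸ Nat.le_mul_of_pos_right m hr
      exact_mod_cast this
    have hn0 : (0 : ℝ) ≤ n := Nat.cast_nonneg n
    set q : ℝ := l * (n + 1) with hq
    have e1 : (n : ℝ) * l + 1 ≤ q := by rw [hq]; linarith
    have e2 : (m : ℝ) + 1 ≤ q := by linarith
    have e3 : (n : ℝ) + 1 ≤ q := by rw [hq]; nlinarith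
    have e4 : (n : ℝ) * l ≤ q := by linarith
    have hq0 : 0 ≤ q := by positivity
    have hpoly : polyFactor l r n m * ((n : ℝ) + 1) ^ 2 ≤ 2 * q ^ K := by
      calc _ ≤ 2 * (q ^ 2) ^ (8 * l * r) * q ^ (r + 1) * q * q ^ 2 := by
            unfold polyFactor; gcongr
        _ = _ := by rw [hK, ← pow_mul]; ring
    have hexp : Real.exp (-(n * c)) = Real.exp c * Real.exp (-(c * ((n : ℝ) + 1))) := by
      rw [← Real.exp_add]; congr 1; ring
    have hqK : q ^ K = (l / c) ^ K * (c * ((n : ℝ) + 1)) ^ K := by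
      rw [← mul_pow, hq]; congr 1; field_simp
    calc _ ≤ 2 * q ^ K * Real.exp (-(n * c)) :=
          mul_le_mul_of_nonneg_right hpoly (Real.exp_pos _).le
      _ = _ := by rw [hexp, hqK]; ring

/-- Without noise `x_c` is a free coordinate, so that the maximiser is not unique. -/
lemma ne_zero_of_argmax {l r : ℕ} {p : ℝ}
    (hmax : argmax (fun z : ℝ × ℝ × (Fin (r / 2) → ℝ) => f l r z.1 z.2.1 z.2.2 p + k z.1 z.2.1 p p)
      (typeDomain r p) = {(0, 0, 0)}) : p ≠ 0 := by
  rintro rfl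
  have h0 : ((0, 0, 0) : ℝ × ℝ × (Fin (r / 2) → ℝ)) ∈ argmax
      (fun z : ℝ × ℝ × (Fin (r / 2) → ℝ) => f l r z.1 z.2.1 z.2.2 0 + k z.1 z.2.1 0 0)
      (typeDomain r 0) := by rw [hmax]; rfl
  have h1 : ((0, 1, 0) : ℝ × ℝ × (Fin (r / 2) → ℝ)) ∈ argmax
      (fun z : ℝ × ℝ × (Fin (r / 2) → ℝ) => f l r z.1 z.2.1 z.2.2 0 + k z.1 z.2.1 0 0)
      (typeDomain r 0) := by
    refine ⟨by simp [typeDomain], fun w hw => (h0.2 w hw).trans_eq ?_⟩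
    simp [f, k]
  rw [hmax] at h1
  simp at h1

end LDPC

theorem theorem2 (l r : ℕ) (hl : 3 ≤ l) (hr : l < r) (p : ℝ) (hp : p ∈ Set.Icc (0 : ℝ) (1 / 2))
    (hmax : LDPC.argmax
      (fun z : ℝ × ℝ × (Fin (r / 2) → ℝ) => LDPC.f l r z.1 z.2.1 z.2.2 p + LDPC.k z.1 z.2.1 p p)
      (LDPC.typeDomain r p) = {(0, 0, 0)}) :
    Filter.Tendsto (fun n : ℕ => LDPC.expectedBitErrorProb l r n p)
      (Filter.atTop ⊓ Filter.principal {n : ℕ | r ∣ n * l}) (nhds 0) := by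
  have h0 : 0 < p := lt_of_le_of_ne hp.1 (LDPC.ne_zero_of_argmax hmax).symm
  have h1 : p < 1 := by linarith [hp.2]
  have hl0 : 0 < l := by lia
  have hr0 : 0 < r := by lia
  rw [Metric.tendsto_nhds]
  intro ε hε
  obtain ⟨c, hc, hgap⟩ := LDPC.exists_exponent_gap hmax (δ := ε / 3) (by positivity)
  obtain ⟨B, hB, hBle⟩ := LDPC.exists_polyFactor_le hl0 hr0 hc
  have hA : Filter.Tendsto (fun n : ℕ => 1 / ((n : ℝ) * c ^ 2)) Filter.atTop (nhds 0) :=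
    tendsto_const_nhds.div_atTop
      (tendsto_natCast_atTop_atTop.atTop_mul_const (by positivity : 0 < c ^ 2))
  rw [Filter.eventually_inf_principal]
  filter_upwards [hA.eventually_lt_const (show 0 < ε / 3 by positivity),
    hB.eventually_lt_const (show 0 < ε / 3 by positivity),
    Filter.eventually_gt_atTop (2 * r)] with n hAn hBn hn hdvd
  have hN : n * l = n * l / r * r := (Nat.div_mul_cancel hdvd).symm
  have hsum := LDPC.sum_bitErrorProb_le hl0 hr0 hn hN h0 h1 (by positivity) hc hgap
  have hnonneg : 0 ≤ LDPC.expectedBitErrorProb l r n p :=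
    div_nonneg (Finset.sum_nonneg fun Γ _ => LDPC.bitErrorProb_nonneg (by lia) Γ h0 h1)
      (Nat.cast_nonneg _)
  rw [Real.dist_eq, sub_zero, abs_of_nonneg hnonneg]
  have hlt := hBle n _ hN
  refine lt_of_le_of_lt (b := 1 / ((n : ℝ) * c ^ 2) + ε / 3 + B n) ?_ (by linarith)
  have hpos : 0 ≤ B n := le_trans (by unfold LDPC.polyFactor; positivity) hlt
  -- if there are no regular graphs, the expectation is `0 / 0 = 0`
  refine div_le_of_le_mul₀ (Nat.cast_nonneg _) (by positivity) ?_
  exact (hsum.trans (mul_le_mul_of_nonneg_left (add_le_add le_rfl hlt)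
    (Nat.cast_nonneg _))).trans_eq (mul_comm _ _)
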